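/- Let $L_{\rm horiz}=\{(x,y): x\le 1,\ 0\le y\le 1\}$, $L_{\rm vert}=\{(x,y): y\le 1,\ 0\le x\le 1\}$, $L=L_{\rm horiz}\cup L_{\rm vert}$, and let $R_t=\begin{pmatrix}\cos t&-\sin t\\ \sin t&\cos t\end{pmatrix}$, $\mu_t=(\cos t,\sin t)^\top$, $\nu_t=(-\sin t,\cos t)^\top$. A rotation path is a continuous $\mathbf x:[0,\pi/2]\to\mathbb R^2$ with $\mathbf x(0)=0$; its associated shape is $$S_{\mathbf x}=L_{\rm horiz}\cap\bigcap_{0\le t\le \pi/2}\big(\mathbf x(t)+R_t(L)\big)\cap\big(\mathbf x(\pi/2)+R_{\pi/2}(L_{\rm vert})\big).$$ A contact point at time $t$ is a point where $S_{\mathbf x}$ touches the inner corner $\mathbf x(t)$ or a wall of the hallway $\mathbf x(t)+R_t(L)$. It is labelled $\mathbf x$ (inner corner), or $\mathbf A,\mathbf B,\mathbf C,\mathbf D$ according as it lies on the image under $p\mapsto\mathbf x(t)+R_tp$ of the wall $\{x=1,y\le 1\}$, $\{x=0,y<0\}$, $\{y=1,x\le 1\}$, $\{y=0,x<0\}$,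 respectively. $\Gamma_{\mathbf x}(t)$ is the set of labels of the contact points that exist at time $t$, and $\mathbf A(t),\dots,\mathbf D(t)$ are the contact paths. (Where $\mathbf x$ is differentiable, each wall has at most one contact point.) For $0<t<\pi/2$ the path is well-behaved at $t$ if it is twice continuously differentiable at $t$ and: if $\mathbf x\in\Gamma_{\mathbf x}(t)$ then $\langle\mathbf x'(t),\nu_t\rangle\ge0$ and $\langle\mathbf x'(t),\mu_t\rangle\le0$; if $\mathbf A\in\Gamma_{\mathbf x}(t)$ then $\langle\mathbf A'(t),\nu_t\rangle\ge0$; if $\mathbf B\in\Gamma_{\mathbf x}(t)$ then $\langle\mathbf B'(t),\nu_t\rangle\le0$; if $\mathbf C\in\Gamma_{\mathbf x}(t)$ then $\langle\mathbf C'(t),\mu_t\rangle\le0$; if $\mathbf D\in\Gamma_{\mathbf x}(t)$ then $\langle\mathbf D'(t),\mu_t\rangle\ge0$. The contacts at $t$ are simple if each contact point at time $t$ either is stationary (its contact path is constant near $t$), or touches the boundary of the hallway only at time $t$: it lies in the interior of $\mathbf x(s)+R_s(L)$ for all $s\in[0,\pi/2]\setminus\{t\}$ and in the interiors of $L_{\rm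 horiz}$ and of $\mathbf x(\pi/2)+R_{\pi/2}(L_{\rm vert})$. **Theorem.** Let $\mathbf x$ be a rotation path, let $t\in(0,\pi/2)$, and suppose that $\mathbf x$ is well-behaved at $t$, that the contacts at $t$ are simple, and that $S_{\mathbf x}$ solves the moving sofa problem, i.e. has maximal area among the shapes associated with rotation paths. Suppose that $\Gamma_{\mathbf x}$ is constant in a neighbourhood of $t$ and equal there to one of the six sets below. Then $\mathbf x''(t)=R_t\big(v+M\,\mathbf x'(t)\big)$, where, with $c=\cos t$ and $s=\sin t$: 1. $\{\mathbf A,\mathbf C,\mathbf D\}$: $v=\binom{-1}{-1/2}$, $M=\begin{pmatrix}2s&-2c\\2c&2s\end{pmatrix}$, and moreover $\mathbf A'(t)=\mathbf 0$; 2. $\{\mathbf x,\mathbf A,\mathbf C,\mathbf D\}$: $v=\binom{-1}{-1/2}$, $M=\begin{pmatrix}s&-c\\\frac32c&\frac32s\end{pmatrix}$; 3. $\{\mathbf x,\mathbf A,\mathbf C\}$: $v=\binom{-1}{-1}$, $M=\begin{pmatrix}s&-c\\c&s\end{pmatrix}$; 4. $\{\mathbf x,\mathbf A,\mathbf B,\mathbf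 C\}$: $v=\binom{-1/2}{-1}$, $M=\begin{pmatrix}\frac32s&-\frac32c\\c&s\end{pmatrix}$; 5. $\{\mathbf A,\mathbf B,\mathbf C\}$: $v=\binom{-1/2}{-1}$, $M=\begin{pmatrix}2s&-2c\\2c&2s\end{pmatrix}$, and moreover $\mathbf C'(t)=\mathbf 0$; 6. $\{\mathbf x,\mathbf A,\mathbf B,\mathbf C,\mathbf D\}$: $v=\binom{-1/2}{-1/2}$, $M=\begin{pmatrix}\frac32s&-\frac32c\\\frac32c&\frac32s\end{pmatrix}$. -/

import Mathlib

open Set Filter Topology MeasureTheory Matrix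

namespace MovingSofa

noncomputable section

/-- The Euclidean plane. -/
abbrev Plane : Type := EuclideanSpace ℝ (Fin 2)

/-- The horizontal arm of the hallway. -/
def Lhoriz : Set Plane := {p | p 0 ≤ 1 ∧ 0 ≤ p 1 ∧ p 1 ≤ 1}

/-- The vertical arm of the hallway. -/
def Lvert : Set Plane := {p | p 1 ≤ 1 ∧ 0 ≤ p 0 ∧ p 0 ≤ 1}

/-- The L-shaped hallway. -/
def L : Set Plane := Lhoriz ∪ Lvert

/-- The matrix of the rotation by the angle `t`. -/
def rotMat (t : ℝ) : Matrix (Fin 2) (Fin 2) ℝ :=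
  !![Real.cos t, -Real.sin t; Real.sin t, Real.cos t]

/-- The set `x(t) + R_t(K)`: the copy of `K` rotated by `t` and then translated by `x t`. -/
def place (x : ℝ → Plane) (t : ℝ) (K : Set Plane) : Set Plane :=
  (fun p : Plane => x t + WithLp.toLp 2 (rotMat t *ᵥ p.ofLp)) '' K

/-- The rotating frame: `μ_t = (cos t, sin t)`. -/
def mu (t : ℝ) : Plane := !₂[Real.cos t, Real.sin t]

/-- The rotating frame: `ν_t = (-sin t, cos t)`. -/
def nu (t : ℝ) : Plane := !₂[-Real.sin t, Real.cos t]

/-- A rotation path is a continuous path on `[0, π/2]` starting at the origin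
(values outside `[0, π/2]` play no role). -/
def IsRotationPath (x : ℝ → Plane) : Prop :=
  ContinuousOn x (Icc 0 (Real.pi / 2)) ∧ x 0 = 0

/-- The shape `S_x` associated with the path `x`. -/
def shape (x : ℝ → Plane) : Set Plane :=
  Lhoriz ∩ (⋂ t ∈ Icc (0 : ℝ) (Real.pi / 2), place x t L) ∩ place x (Real.pi / 2) Lvert

/-- `S_x` solves the moving sofa problem: its area is maximal among the shapes associated with
rotation paths. -/
def IsAreaMaximal (x : ℝ → Plane) : Prop :=
  ∀ y : ℝ → Plane, IsRotationPath y → volume (shape y) ≤ volume (shape x)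

/-- The labels of the five possible contact points: `x` is the inner corner of the hallway,
`A` and `C` belong to the outer walls, `B` and `D` to the inner walls. -/
inductive Label : Type
  | x | A | B | C | D

/-- The inner corner and the four walls of the unmoved hallway. The inner walls do not contain
the inner corner, which is counted separately. -/
def wall : Label → Set Plane
  | .x => {0}
  | .A => {p | p 0 = 1 ∧ p 1 ≤ 1}
  | .B => {p | p 0 = 0 ∧ p 1 < 0}
  | .C => {p | p 1 = 1 ∧ p 0 ≤ 1}
  | .D => {p | p 1 = 0 ∧ p 0 < 0}

/-- The points at which the shape touches the wall (or corner) `w` of the hallway at time `t`. -/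
def contactSet (x : ℝ → Plane) (w : Label) (t : ℝ) : Set Plane :=
  shape x ∩ place x t (wall w)

/-- `Γ_x(t)`: the set of (labels of) the contact points at time `t`. -/
def Gamma (x : ℝ → Plane) (t : ℝ) : Set Label := {w | (contactSet x w t).Nonempty}

open Classical in
/-- The contact paths `x(t)`, `A(t)`, `B(t)`, `C(t)`, `D(t)`, with the value `0` where there is no
contact point. At a time `t` in `(0, π/2)` at which `x` is differentiable each wall has at most
one contact point, so no choice is involved there. -/
def contactPath (x : ℝ → Plane) (w : Label) (t : ℝ) : Plane :=
  if h : (contactSet x w t).Nonempty then h.some else 0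

/-- The path `x` is well-behaved at `t`. -/
structure WellBehaved (x : ℝ → Plane) (t : ℝ) : Prop where
  contDiffAt : ContDiffAt ℝ 2 x t
  corner : Label.x ∈ Gamma x t → 0 ≤ inner ℝ (deriv x t) (nu t) ∧ inner ℝ (deriv x t) (mu t) ≤ 0
  wallA : Label.A ∈ Gamma x t → 0 ≤ inner ℝ (deriv (contactPath x .A) t) (nu t)
  wallB : Label.B ∈ Gamma x t → inner ℝ (deriv (contactPath x .B) t) (nu t) ≤ 0
  wallC : Label.C ∈ Gamma x t → inner ℝ (deriv (contactPath x .C) t) (mu t) ≤ 0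
  wallD : Label.D ∈ Gamma x t → 0 ≤ inner ℝ (deriv (contactPath x .D) t) (mu t)

/-- Among all the sets whose intersection is `S_x`, only the hallway at time `t` has no
neighbourhood of `p` in it: the point `p` lies inside the hallway at all the other times, and
inside the initial and the final arm. -/
def OnlyAt (x : ℝ → Plane) (t : ℝ) (p : Plane) : Prop :=
  p ∈ interior Lhoriz ∧ p ∈ interior (place x (Real.pi / 2) Lvert) ∧
    ∀ s ∈ Icc (0 : ℝ) (Real.pi / 2), s ≠ t → p ∈ interior (place x s L)

/-- Every contact point at time `t` either stays fixed for a while or is a contact point at no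
time other than `t`. -/
def SimpleContacts (x : ℝ → Plane) (t : ℝ) : Prop :=
  ∀ w ∈ Gamma x t,
    (∀ᶠ s in 𝓝 t, contactPath x w s = contactPath x w t) ∨ OnlyAt x t (contactPath x w t)

/-- The differential equation `x''(t) = R_t (v + M x'(t))` at the point `t`. -/
def SatisfiesODE (x : ℝ → Plane) (t : ℝ) (v : Fin 2 → ℝ) (M : Matrix (Fin 2) (Fin 2) ℝ) : Prop :=
  deriv (deriv x) t = WithLp.toLp 2 (rotMat t *ᵥ (v + M *ᵥ (deriv x t).ofLp))

end

end MovingSofa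

namespace MovingSofa

/-! The proof is a first variation. Let `e` be one of the frame vectors `mu`, `nu` and `f` the
other, with a sign `σ` recording the orientation. Replace `x s` by `x s + ε φ(s) e(s)`, where `φ` is
a cutoff near `t`. Only the two walls orthogonal to `e` and the inner corner are affected. To first
order in `ε`, area is gained along the short arc traced by the contact point on the outer wall and
lost along the arcs traced by the contact points on the inner wall and at the corner. Each amount is
`ε` times the extent of the arc in the direction `f`. Replacing `ε` by `-ε` exchanges gains and
losses, so maximality gives two opposite inequalities (`IsFrame.outer_rate_le`,
`IsFrame.sum_inner_rate_le`) and hence the equality `IsFrame.balance`.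

The speeds in this equality are explicit. At a wall contact the distance of a fixed point of the
shape to the wall is extremal in time, so by Fermat the contact point is `x + σ⟨x', e⟩ f` on the
inner wall, and the same plus `e` on the outer one (`innerContact`, `outerContact`). These points
slide along `f` with velocities `σρ` and `σ(ρ + 1)`, where `ρ = 2σ⟨x', f⟩ + ⟨x'', e⟩`. Good
behaviour fixes the signs, so that absolute values disappear and the balance is linear: `ρ + 1`
equals `σ⟨x', f⟩` if the corner touches, plus `-ρ` if the inner wall does. The two choices of `e`
determine both components of `x''`.

Losses are bounded above by compactness. Gains need the simplicity of the contacts: a point added to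
the shape must still satisfy the constraints of all other times. A contact point of speed zero needs
no gain estimate. -/

theorem inner_plane (p q : Plane) : inner ℝ p q = p 0 * q 0 + p 1 * q 1 := by
  simp [PiLp.inner_apply, Fin.sum_univ_two, mul_comm]

/-! ### Moving frames -/

/-- A moving orthonormal frame adapted to the hallway: either `(μ, ν)`, with `σ = 1`, or
`(ν, μ)`, with `σ = -1`. -/
structure IsFrame (σ : ℝ) (e f : ℝ → Plane) : Prop where
  sign : σ = 1 ∨ σ = -1
  inner_ee : ∀ a b, inner ℝ (e a) (e b) = Real.cos (a - b)
  inner_ff : ∀ a b, inner ℝ (f a) (f b) = Real.cos (a - b)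
  inner_ef : ∀ a b, inner ℝ (e a) (f b) = σ * Real.sin (a - b)
  deriv_e : ∀ s, HasDerivAt e (σ • f s) s
  deriv_f : ∀ s, HasDerivAt f (-(σ • e s)) s
  mem_place : ∀ (x : ℝ → Plane) (s : ℝ) (p : Plane), p ∈ place x s L ↔
    inner ℝ (p - x s) (e s) ≤ 1 ∧ inner ℝ (p - x s) (f s) ≤ 1 ∧
      (0 ≤ inner ℝ (p - x s) (e s) ∨ 0 ≤ inner ℝ (p - x s) (f s))

theorem mem_place_iff (x : ℝ → Plane) (s : ℝ) (K : Set Plane) (p : Plane) :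
    p ∈ place x s K ↔ !₂[inner ℝ (p - x s) (mu s), inner ℝ (p - x s) (nu s)] ∈ K := by
  have hc := Real.sin_sq_add_cos_sq s
  constructor
  · rintro ⟨q, hq, rfl⟩
    convert hq using 1
    ext i
    fin_cases i
    · simp [inner_plane, mu, nu, rotMat, dotProduct, Fin.sum_univ_two]
      linear_combination q.ofLp 0 * hc
    · simp [inner_plane, mu, nu, rotMat, dotProduct, Fin.sum_univ_two]
      linear_combination q.ofLp 1 * hc
  · intro h
    refine ⟨_, h, ?_⟩
    ext i
    fin_cases i
    · simp [inner_plane, mu, nu, rotMat]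
      linear_combination (p.ofLp 0 - (x s).ofLp 0) * hc
    · simp [inner_plane, mu, nu, rotMat]
      linear_combination (p.ofLp 1 - (x s).ofLp 1) * hc

theorem mem_L_iff (a b : ℝ) : (!₂[a, b] : Plane) ∈ L ↔ a ≤ 1 ∧ b ≤ 1 ∧ (0 ≤ a ∨ 0 ≤ b) := by
  simp only [L, Lhoriz, Lvert, mem_union, mem_ofPred_eq]
  simp
  constructor
  · rintro (⟨h1, h2, h3⟩ | ⟨h1, h2, h3⟩)
    · exact ⟨h1, h3, Or.inr h2⟩
    · exact ⟨h3, h1, Or.inl h2⟩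
  · rintro ⟨h1, h2, h3 | h3⟩
    · exact Or.inr ⟨h2, h3, h1⟩
    · exact Or.inl ⟨h1, h3, h2⟩

theorem hasDerivAt_mu (s : ℝ) : HasDerivAt mu (nu s) s := by
  convert ((Real.hasDerivAt_cos s).smul_const (!₂[1, 0] : Plane)).add
    ((Real.hasDerivAt_sin s).smul_const (!₂[0, 1] : Plane)) using 1
  · rfl
  · rfl
  · rfl
  · ext r i; fin_cases i <;> simp [mu]
  · ext i; fin_cases i <;> simp [nu]

theorem hasDerivAt_nu (s : ℝ) : HasDerivAt nu (-mu s) s := by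
  convert ((Real.hasDerivAt_sin s).neg.smul_const (!₂[1, 0] : Plane)).add
    ((Real.hasDerivAt_cos s).smul_const (!₂[0, 1] : Plane)) using 1
  · rfl
  · rfl
  · rfl
  · ext r i; fin_cases i <;> simp [nu]
  · ext i; fin_cases i <;> simp [mu]

theorem isFrame_mu_nu : IsFrame 1 mu nu where
  sign := Or.inl rfl
  inner_ee a b := by simp [inner_plane, mu, Real.cos_sub]
  inner_ff a b := by simp [inner_plane, nu, Real.cos_sub]; ring
  inner_ef a b := by simp [inner_plane, mu, nu, Real.sin_sub]; ring
  deriv_e s := by simpa using hasDerivAt_mu s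
  deriv_f s := by simpa using hasDerivAt_nu s
  mem_place x s p := by rw [mem_place_iff, mem_L_iff]

theorem isFrame_nu_mu : IsFrame (-1) nu mu where
  sign := Or.inr rfl
  inner_ee a b := by simp [inner_plane, nu, Real.cos_sub]; ring
  inner_ff a b := by simp [inner_plane, mu, Real.cos_sub]
  inner_ef a b := by simp [inner_plane, mu, nu, Real.sin_sub]; ring
  deriv_e s := by simpa using hasDerivAt_nu s
  deriv_f s := by simpa using hasDerivAt_mu s
  mem_place x s p := by rw [mem_place_iff, mem_L_iff]; tauto

namespace IsFrame

variable {σ : ℝ} {e f : ℝ → Plane}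

theorem sq (H : IsFrame σ e f) : σ * σ = 1 := by
  rcases H.sign with h | h <;> simp [h]

theorem abs_sign (H : IsFrame σ e f) : |σ| = 1 := by
  rcases H.sign with h | h <;> simp [h]

theorem inner_fe (H : IsFrame σ e f) (a b : ℝ) :
    inner ℝ (f a) (e b) = σ * Real.sin (b - a) := by
  rw [real_inner_comm, H.inner_ef]

theorem norm_e (H : IsFrame σ e f) (s : ℝ) : ‖e s‖ = 1 := by
  have := H.inner_ee s s
  rw [real_inner_self_eq_norm_sq, sub_self, Real.cos_zero] at this
  nlinarith [norm_nonneg (e s)]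

theorem norm_f (H : IsFrame σ e f) (s : ℝ) : ‖f s‖ = 1 := by
  have := H.inner_ff s s
  rw [real_inner_self_eq_norm_sq, sub_self, Real.cos_zero] at this
  nlinarith [norm_nonneg (f s)]

theorem orthonormal (H : IsFrame σ e f) (s : ℝ) : Orthonormal ℝ ![e s, f s] := by
  refine ⟨fun i => ?_, fun i j hij => ?_⟩
  · fin_cases i
    · exact H.norm_e s
    · exact H.norm_f s
  · fin_cases i <;> fin_cases j <;> simp [H.inner_ef, H.inner_fe] at hij ⊢

/-- The frame at a given time, as an orthonormal basis. -/
noncomputable def basis (H : IsFrame σ e f) (s : ℝ) : OrthonormalBasis (Fin 2) ℝ Plane :=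
  (basisOfOrthonormalOfCardEqFinrank (H.orthonormal s) (by simp)).toOrthonormalBasis
    (by simpa using H.orthonormal s)

theorem basis_zero (H : IsFrame σ e f) (s : ℝ) : H.basis s 0 = e s := by simp [basis]

theorem basis_one (H : IsFrame σ e f) (s : ℝ) : H.basis s 1 = f s := by simp [basis]

theorem expand (H : IsFrame σ e f) (s : ℝ) (p : Plane) :
    inner ℝ p (e s) • e s + inner ℝ p (f s) • f s = p := by
  have := (H.basis s).sum_repr' p
  simp only [Fin.sum_univ_two, basis_zero, basis_one] at this
  rwa [real_inner_comm (e s), real_inner_comm (f s)]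

theorem continuous_e (H : IsFrame σ e f) : Continuous e :=
  continuous_iff_continuousAt.2 fun s => (H.deriv_e s).continuousAt

theorem continuous_f (H : IsFrame σ e f) : Continuous f :=
  continuous_iff_continuousAt.2 fun s => (H.deriv_f s).continuousAt

/-! ### Areas by slicing along a frame vector -/

theorem measurePreserving (H : IsFrame σ e f) (s : ℝ) :
    MeasurePreserving (fun q : ℝ × ℝ => q.1 • e s + q.2 • f s) := by
  have h := ((H.basis s).measurePreserving_repr_symm).comp
    ((EuclideanSpace.volume_preserving_symm_measurableEquiv_toLp (Fin 2)).symm.comp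
    (volume_preserving_finTwoArrow ℝ).symm)
  convert h using 1
  · rfl
  · rfl
  ext1 q
  change _ = (H.basis s).repr.symm _
  rw [← (H.basis s).sum_repr_symm]
  simp [Fin.sum_univ_two, basis_zero, basis_one, MeasurableEquiv.finTwoArrow]

/-- Cavalieri's principle in the frame at time `s`. -/
theorem volume_eq_lintegral (H : IsFrame σ e f) (s : ℝ) {E : Set Plane} (hE : MeasurableSet E) :
    volume E = ∫⁻ b : ℝ, volume {a : ℝ | a • e s + b • f s ∈ E} := by
  rw [← (H.measurePreserving s).measure_preimage hE.nullMeasurableSet, Measure.volume_eq_prod,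
    Measure.prod_apply_symm ((H.measurePreserving s).measurable hE)]
  rfl

/-- A set whose sections along `e s` have length at most `w`, and whose projection to `f s` has
length at most `l`, has area at most `w * l`. -/
theorem volume_le (H : IsFrame σ e f) (s : ℝ) {E : Set Plane} (hE : MeasurableSet E) {w c r : ℝ}
    (hr : ∀ p ∈ E, |inner ℝ p (f s) - c| ≤ r)
    (hw : ∀ p ∈ E, ∀ l, 0 < l → p + l • e s ∈ E → l ≤ w) (hw0 : 0 ≤ w) :
    volume E ≤ ENNReal.ofReal (w * (2 * r)) := by
  rw [H.volume_eq_lintegral s hE]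
  have key : ∀ b : ℝ, volume {a : ℝ | a • e s + b • f s ∈ E} ≤
      (Icc (c - r) (c + r)).indicator (fun _ => ENNReal.ofReal w) b := by
    intro b
    have hib : ∀ a : ℝ, inner ℝ (a • e s + b • f s) (f s) = b := by
      intro a
      rw [inner_add_left, inner_smul_left, inner_smul_left, H.inner_ef, H.inner_ff]; simp
    by_cases hb : b ∈ Icc (c - r) (c + r)
    · rw [indicator_of_mem hb]
      refine (Real.volume_le_diam _).trans ?_
      refine Metric.ediam_le fun a ha a' ha' => ?_
      rw [edist_dist]
      refine ENNReal.ofReal_le_ofReal ?_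
      have aux : ∀ a a' : ℝ, a • e s + b • f s ∈ E → a' • e s + b • f s ∈ E → a < a' →
          a' - a ≤ w := by
        intro a a' h h' hlt
        refine hw _ h _ (sub_pos.2 hlt) ?_
        convert h' using 1
        module
      rcases lt_trichotomy a a' with h | h | h
      · rw [Real.dist_eq, abs_sub_comm, abs_of_pos (sub_pos.2 h)]; exact aux _ _ ha ha' h
      · simpa [h] using hw0
      · rw [Real.dist_eq, abs_of_pos (sub_pos.2 h)]; exact aux _ _ ha' ha h
    · have : {a : ℝ | a • e s + b • f s ∈ E} = ∅ := by
        ext a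
        simp only [mem_ofPred_eq, mem_empty_iff_false, iff_false]
        intro ha
        have := abs_le.1 (hr _ ha)
        rw [hib] at this
        exact hb ⟨by linarith, by linarith⟩
      simp [this]
  refine (lintegral_mono key).trans ?_
  rw [lintegral_indicator measurableSet_Icc, setLIntegral_const, Real.volume_Icc,
    ← ENNReal.ofReal_mul hw0]
  exact le_of_eq (by congr 1; ring)

/-- A set that contains a segment of length `w` along `e s` over every point of an interval
has area at least `w` times the length of the interval. -/
theorem le_volume (H : IsFrame σ e f) (s : ℝ) {E : Set Plane} (hE : MeasurableSet E) {w b₁ b₂ : ℝ}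
    (hw0 : 0 ≤ w)
    (hw : ∀ b ∈ Icc b₁ b₂, ∃ p : Plane, inner ℝ p (f s) = b ∧
      ((∀ u ∈ Ioo 0 w, p + u • e s ∈ E) ∨ (∀ u ∈ Ioo 0 w, p + (-u) • e s ∈ E))) :
    ENNReal.ofReal (w * (b₂ - b₁)) ≤ volume E := by
  rw [H.volume_eq_lintegral s hE]
  have key : ∀ b : ℝ, (Icc b₁ b₂).indicator (fun _ => ENNReal.ofReal w) b ≤
      volume {a : ℝ | a • e s + b • f s ∈ E} := by
    intro b
    by_cases hb : b ∈ Icc b₁ b₂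
    · rw [indicator_of_mem hb]
      obtain ⟨p, rfl, hp⟩ := hw b hb
      have hexp := H.expand s p
      rcases hp with hp | hp
      · have : ENNReal.ofReal w = volume (Ioo (inner ℝ p (e s)) (inner ℝ p (e s) + w)) := by
          rw [Real.volume_Ioo]; congr 1; ring
        rw [this]
        refine measure_mono fun a ha => ?_
        have := hp (a - inner ℝ p (e s)) ⟨by linarith [ha.1], by linarith [ha.2]⟩
        rw [mem_ofPred_eq]
        convert this using 1
        nth_rewrite 2 [← hexp]
        module
      · have : ENNReal.ofReal w = volume (Ioo (inner ℝ p (e s) - w) (inner ℝ p (e s))) := by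
          rw [Real.volume_Ioo]; congr 1; ring
        rw [this]
        refine measure_mono fun a ha => ?_
        have := hp (inner ℝ p (e s) - a) ⟨by linarith [ha.2], by linarith [ha.1]⟩
        rw [mem_ofPred_eq]
        convert this using 1
        nth_rewrite 2 [← hexp]
        module
    · rw [indicator_of_notMem hb]; exact zero_le
  refine le_trans ?_ (lintegral_mono key)
  rw [lintegral_indicator measurableSet_Icc, setLIntegral_const, Real.volume_Icc,
    ← ENNReal.ofReal_mul hw0]

end IsFrame

/-! ### Shapes of perturbed paths -/

/-- The coordinate of the point `p` in the direction `g s`, measured from `x s`. -/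
noncomputable def along (x g : ℝ → Plane) (s : ℝ) (p : Plane) : ℝ := inner ℝ (p - x s) (g s)

theorem along_add_smul (x g : ℝ → Plane) (s : ℝ) (p w : Plane) (u : ℝ) :
    along x g s (p + u • w) = along x g s p + u * inner ℝ w (g s) := by
  rw [along, along, add_sub_right_comm, inner_add_left, inner_smul_left]; rfl

theorem continuous_along (x g : ℝ → Plane) (s : ℝ) : Continuous (along x g s) := by
  unfold along; fun_prop

theorem continuousOn_along {x g : ℝ → Plane} {J : Set ℝ} (hx : ContinuousOn x J)
    (hg : Continuous g) : ContinuousOn (fun q : ℝ × Plane => along x g q.1 q.2) (J ×ˢ univ) := by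
  unfold along
  have h1 : ContinuousOn (fun q : ℝ × Plane => x q.1) (J ×ˢ univ) :=
    hx.comp continuousOn_fst fun q hq => hq.1
  exact (continuousOn_snd.sub h1).inner (hg.comp continuous_fst).continuousOn

/-- The shape that arises when the hallway at time `s` is moved by `h s` in the direction `e s`. -/
def movedShape (K : Set Plane) (x e f : ℝ → Plane) (h : ℝ → ℝ) : Set Plane :=
  {p | p ∈ K ∧ ∀ s ∈ Icc (0 : ℝ) (Real.pi / 2), along x e s p ≤ 1 + h s ∧ along x f s p ≤ 1 ∧
    (h s ≤ along x e s p ∨ 0 ≤ along x f s p)}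

theorem isClosed_movedShape {K : Set Plane} (hK : IsClosed K) (x e f : ℝ → Plane) (h : ℝ → ℝ) :
    IsClosed (movedShape K x e f h) := by
  have : movedShape K x e f h = K ∩ ⋂ s ∈ Icc (0 : ℝ) (Real.pi / 2),
      ({p | along x e s p ≤ 1 + h s} ∩ ({p | along x f s p ≤ 1} ∩
        ({p | h s ≤ along x e s p} ∪ {p | 0 ≤ along x f s p}))) := by
    ext p; simp [movedShape]
  rw [this]
  refine hK.inter (isClosed_biInter fun s _ => ?_)
  have he := continuous_along x e s
  have hf := continuous_along x f s
  exact (isClosed_le he continuous_const).inter ((isClosed_le hf continuous_const).inter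
    ((isClosed_le continuous_const he).union (isClosed_le continuous_const hf)))

/-- Translating the hallway along `e s` changes only the `e`-coordinate relative to it, and the
final arm stays put because `h` vanishes at `π / 2`. All perturbed shapes thus become intersections
over the same `K` and `x`. -/
theorem shape_add_smul {σ : ℝ} {e f : ℝ → Plane} (H : IsFrame σ e f) (x : ℝ → Plane) {h : ℝ → ℝ}
    (h1 : h (Real.pi / 2) = 0) :
    shape (fun s => x s + h s • e s) =
      movedShape (Lhoriz ∩ place x (Real.pi / 2) Lvert) x e f h := by
  have e1 : ∀ s p, inner ℝ (p - (x s + h s • e s)) (e s) = along x e s p - h s := by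
    intro s p
    have := H.inner_ee s s
    rw [← sub_sub, inner_sub_left, inner_smul_left, this]; simp [along]
  have e2 : ∀ s p, inner ℝ (p - (x s + h s • e s)) (f s) = along x f s p := by
    intro s p
    have := H.inner_ef s s
    rw [← sub_sub, inner_sub_left, inner_smul_left, this]; simp [along]
  have e3 : place (fun s => x s + h s • e s) (Real.pi / 2) Lvert =
      place x (Real.pi / 2) Lvert := by
    simp [place, h1]
  ext p
  simp only [shape, movedShape, e3, mem_inter_iff, mem_iInter, H.mem_place, e1, e2, mem_ofPred_eq,
    tsub_le_iff_right, sub_nonneg]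
  tauto

/-! ### Uniformity near `t` and compactness -/

/-- A uniform form of strict differentiability, tested against a moving direction. -/
theorem exists_inner_sub_estimate {P g : ℝ → Plane} {v : Plane} {t : ℝ}
    (hP : HasStrictDerivAt P v t) (hg : Continuous g) {η : ℝ} (hη : 0 < η) :
    ∃ δ > 0, ∀ s s' θ, |s - t| ≤ δ → |s' - t| ≤ δ → |θ - t| ≤ δ →
      |inner ℝ (P s - P s') (g θ) - inner ℝ v (g t) * (s - s')| ≤ η * |s - s'| := by
  -- The first term pays for the linearization of `P`, the second for the variation of `g θ` around
  -- `g t`.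
  obtain ⟨c, hc, hcη⟩ : ∃ c > 0, c * (‖g t‖ + 1) + ‖v‖ * c ≤ η := by
    refine ⟨η / (‖g t‖ + 1 + ‖v‖), by positivity, le_of_eq ?_⟩
    have : ‖g t‖ + 1 + ‖v‖ ≠ 0 := by positivity
    field_simp
  have h1 := hP.hasStrictFDerivAt.isLittleO.def hc
  obtain ⟨δ₁, hδ₁, h1⟩ := Metric.eventually_nhds_iff.1 h1
  obtain ⟨δ₂, hδ₂, h2⟩ := Metric.continuous_iff.1 hg t (min c 1) (by positivity)
  refine ⟨min δ₁ δ₂ / 2, by positivity, fun s s' θ hs hs' hθ => ?_⟩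
  have hm : min δ₁ δ₂ / 2 < min δ₁ δ₂ := by
    have : 0 < min δ₁ δ₂ := by positivity
    linarith
  have hd1 : dist (s, s') (t, t) < δ₁ := by
    rw [Prod.dist_eq, max_lt_iff]
    exact ⟨(hs.trans_lt hm).trans_le (min_le_left _ _), (hs'.trans_lt hm).trans_le (min_le_left _ _)⟩
  have hd2 : dist θ t < δ₂ := (hθ.trans_lt hm).trans_le (min_le_right _ _)
  have h1 := h1 hd1
  have h2 := h2 θ hd2
  rw [dist_eq_norm, lt_min_iff] at h2
  simp only [ContinuousLinearMap.toSpanSingleton_apply,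
    Real.norm_eq_abs] at h1
  have hgθ : ‖g θ‖ ≤ ‖g t‖ + 1 := by
    have := norm_add_le (g t) (g θ - g t)
    rw [add_sub_cancel] at this
    linarith [h2.2]
  have hid : inner ℝ (P s - P s') (g θ) - inner ℝ v (g t) * (s - s') =
      inner ℝ (P s - P s' - (s - s') • v) (g θ) + (s - s') * inner ℝ v (g θ - g t) := by
    rw [inner_sub_left (P s - P s'), inner_smul_left, inner_sub_right v]; simp; ring
  rw [hid]
  calc _ ≤ |inner ℝ (P s - P s' - (s - s') • v) (g θ)| + |(s - s') * inner ℝ v (g θ - g t)| :=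
        abs_add_le _ _
    _ ≤ c * |s - s'| * (‖g t‖ + 1) + |s - s'| * (‖v‖ * c) := by
        rw [abs_mul]
        gcongr
        · exact (abs_real_inner_le_norm _ _).trans (by gcongr)
        · exact (abs_real_inner_le_norm _ _).trans (by gcongr; exact h2.1.le)
    _ ≤ η * |s - s'| := by nlinarith [abs_nonneg (s - s')]

/-- A compactness principle: where `g ≤ 0` implies membership in an open set, so does `g ≤ ε` for
small `ε`. -/
theorem IsCompact.eventually_mem_of_le {X : Type*} [TopologicalSpace X] {Q V : Set X} {g : X → ℝ}
    (hQ : IsCompact Q) (hV : IsOpen V) (hg : ContinuousOn g Q) (h : ∀ q ∈ Q, g q ≤ 0 → q ∈ V) :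
    ∀ᶠ ε in 𝓝[>] (0 : ℝ), ∀ q ∈ Q, g q ≤ ε → q ∈ V := by
  have hc : IsCompact (Q \ V) := hQ.diff hV
  rcases (Q \ V).eq_empty_or_nonempty with hne | hne
  · exact Eventually.of_forall fun ε q hq _ => by
      by_contra hqV
      have : q ∈ Q \ V := ⟨hq, hqV⟩
      rw [hne] at this
      exact this
  · obtain ⟨q₀, hq₀, hmin⟩ := hc.exists_isMinOn hne (hg.mono sdiff_subset)
    have hpos : 0 < g q₀ := by
      by_contra hle
      exact hq₀.2 (h q₀ hq₀.1 (not_lt.1 hle))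
    filter_upwards [Ioo_mem_nhdsGT hpos] with ε hε q hq hqε
    by_contra hqV
    have := isMinOn_iff.1 hmin q ⟨hq, hqV⟩
    linarith [hε.2]

namespace IsFrame

variable {σ : ℝ} {e f : ℝ → Plane}

/-! ### Areas along short arcs, sliced in a tilted direction -/

/-- The direction, close to `e t`, in which areas near time `t` are measured. -/
theorem inner_e_tilt_e (H : IsFrame σ e f) (t b s : ℝ) :
    inner ℝ (e (t + 2 * σ * b)) (e s) = Real.cos (2 * b + σ * (t - s)) := by
  rw [H.inner_ee]
  rcases H.sign with rfl | rfl
  · congr 1; ring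
  · rw [← Real.cos_neg]; congr 1; ring

theorem inner_e_tilt_f (H : IsFrame σ e f) (t b s : ℝ) :
    inner ℝ (e (t + 2 * σ * b)) (f s) = Real.sin (2 * b + σ * (t - s)) := by
  rw [H.inner_ef]
  rcases H.sign with rfl | rfl
  · rw [one_mul]; congr 1; ring
  · rw [neg_one_mul, ← Real.sin_neg]; congr 1; ring

theorem abs_sign_mul (H : IsFrame σ e f) (r : ℝ) : |σ * r| = |r| := by
  rw [abs_mul, H.abs_sign, one_mul]

/-- The tilt by `2b` makes the slicing direction have a positive `f s`-component for every `s`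
within `b` of `t`. Moving backwards along it from the inner wall or corner therefore never leaves
the region `along x f s < 0`, where the inner wall is effective, while the tilt costs only a factor
`1 - O(b ^ 2)` in length. -/
theorem tilt_angle_mem (H : IsFrame σ e f) {t b s : ℝ} (hs : |s - t| ≤ b) :
    2 * b + σ * (t - s) ∈ Icc b (3 * b) := by
  have := abs_le.1 ((H.abs_sign_mul (t - s)).le.trans (abs_sub_comm t s ▸ hs))
  constructor <;> linarith [this.1, this.2]

theorem inner_e_tilt_f_pos (H : IsFrame σ e f) {t b s : ℝ} (hb : 0 < b) (hb1 : b < 1 / 2)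
    (hs : |s - t| ≤ b) : 0 < inner ℝ (e (t + 2 * σ * b)) (f s) := by
  rw [H.inner_e_tilt_f]
  have := H.tilt_angle_mem hs
  exact Real.sin_pos_of_pos_of_lt_pi (hb.trans_le this.1)
    (by linarith [this.2, Real.pi_gt_three])

theorem inner_e_tilt_f_le (H : IsFrame σ e f) {t b s : ℝ} (hb : 0 < b)
    (hs : |s - t| ≤ b) : inner ℝ (e (t + 2 * σ * b)) (f s) ≤ 3 * b := by
  rw [H.inner_e_tilt_f]
  have := H.tilt_angle_mem hs
  exact (Real.sin_le (hb.le.trans this.1)).trans this.2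

theorem inner_e_tilt_e_ge (H : IsFrame σ e f) {t b s : ℝ} (hb : 0 < b)
    (hs : |s - t| ≤ b) : 1 - 5 * b ^ 2 ≤ inner ℝ (e (t + 2 * σ * b)) (e s) := by
  rw [H.inner_e_tilt_e]
  have := H.tilt_angle_mem hs
  have h1 := Real.one_sub_sq_div_two_le_cos (x := 2 * b + σ * (t - s))
  -- The angle is at most `3b`, and `(3b)² / 2 ≤ 5b²`.
  nlinarith [this.1, this.2]

theorem inner_e_tilt_e_le (H : IsFrame σ e f) (t b s : ℝ) :
    inner ℝ (e (t + 2 * σ * b)) (e s) ≤ 1 := by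
  rw [H.inner_e_tilt_e]; exact Real.cos_le_one _

theorem abs_tilt_sub (H : IsFrame σ e f) {t b : ℝ} (hb : 0 < b) :
    |t + 2 * σ * b - t| = 2 * b := by
  rw [add_sub_cancel_left, mul_comm 2 σ, mul_assoc, H.abs_sign_mul, abs_of_pos (by linarith)]

/-- The area of a set that shrinks to finitely many short arcs, with sections of length about `ε`
along the direction in which the hallway moves. -/
theorem eventually_volume_le (H : IsFrame σ e f) {ι : Type*} [Fintype ι] {P : ι → ℝ → Plane}
    {v : ι → Plane} {t : ℝ} (hP : ∀ i, HasStrictDerivAt (P i) (v i) t) {η : ℝ} (hη : 0 < η) :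
    ∃ δ > 0, ∀ b, 0 < b → b < δ → ∀ Λ : ℝ → Set Plane, (∀ ε, MeasurableSet (Λ ε)) →
      (∀ U : Set Plane, IsOpen U → (∀ i s, |s - t| ≤ b → P i s ∈ U) →
        ∀ᶠ ε in 𝓝[>] (0 : ℝ), Λ ε ⊆ U) →
      (∀ ε > 0, ∀ p ∈ Λ ε, ∀ l, 0 < l → p + l • e (t + 2 * σ * b) ∈ Λ ε →
        ∃ s, |s - t| ≤ b ∧ l * inner ℝ (e (t + 2 * σ * b)) (e s) ≤ ε) →
      ∀ᶠ ε in 𝓝[>] (0 : ℝ),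
        volume (Λ ε) ≤ ENNReal.ofReal (ε * b * (2 * ∑ i, |inner ℝ (v i) (f t)| + η)) := by
  -- The factor `1 + c` absorbs the tilt of the sections. Of the summand `2 * c`, one half is the
  -- linearization error of the arc and the other makes the strips below strict neighbourhoods of
  -- it.
  obtain ⟨c, hc, hcη⟩ : ∃ c > 0,
      (1 + c) * ∑ i, (2 * (|inner ℝ (v i) (f t)| + 2 * c)) <
        2 * ∑ i, |inner ℝ (v i) (f t)| + η := by
    have : Tendsto (fun c : ℝ => (1 + c) * ∑ i, (2 * (|inner ℝ (v i) (f t)| + 2 * c)))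
        (𝓝[>] 0) (𝓝 ((1 + 0) * ∑ i, (2 * (|inner ℝ (v i) (f t)| + 2 * 0)))) := by
      apply Tendsto.mono_left _ nhdsWithin_le_nhds
      apply Continuous.tendsto
      fun_prop
    have h2 := this.eventually_lt_const
      (u := 2 * ∑ i, |inner ℝ (v i) (f t)| + η) (by
      rw [add_zero, one_mul, ← Finset.mul_sum]; simpa using hη)
    obtain ⟨c, h3, h4⟩ := (h2.and self_mem_nhdsWithin).exists
    exact ⟨c, h4, h3⟩
  choose δ hδ hest using fun i => exists_inner_sub_estimate (hP i) H.continuous_f hc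
  obtain ⟨δ', hδ', hδ'i⟩ : ∃ δ' > 0, ∀ i, δ' ≤ δ i := by
    have : ∀ᶠ d in 𝓝[>] (0 : ℝ), ∀ i, d ≤ δ i := by
      rw [eventually_all]
      intro i
      filter_upwards [Ioo_mem_nhdsGT (hδ i)] with d hd using hd.2.le
    obtain ⟨d, h1, h2⟩ := (this.and self_mem_nhdsWithin).exists
    exact ⟨d, h2, h1⟩
  obtain ⟨δ'', hδ'', hcos⟩ : ∃ δ'' > 0, ∀ b, 0 < b → b < δ'' → 1 ≤ (1 + c) * (1 - 5 * b ^ 2) := by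
    have : Tendsto (fun b : ℝ => (1 + c) * (1 - 5 * b ^ 2)) (𝓝 0)
        (𝓝 ((1 + c) * (1 - 5 * 0 ^ 2))) := by
      apply Continuous.tendsto; fun_prop
    have h2 := this.eventually_const_lt (u := 1) (by simpa using hc)
    obtain ⟨d, hd, h3⟩ := Metric.eventually_nhds_iff.1 h2
    exact ⟨d, hd, fun b hb hbd => (h3 (by simpa [abs_of_pos hb] using hbd)).le⟩
  refine ⟨min (δ' / 2) δ'', by positivity, fun b hb hbδ Λ hΛ hU hw => ?_⟩
  have hb1 : b < δ' / 2 := hbδ.trans_le (min_le_left _ _)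
  have hb2 : b < δ'' := hbδ.trans_le (min_le_right _ _)
  set θ := t + 2 * σ * b with hθ
  -- A strip around the `i`-th arc, bounded only in the direction `f θ`. The sections along `e θ`
  -- control the other direction.
  let U : ι → Set Plane := fun i =>
    {p | |inner ℝ p (f θ) - inner ℝ (P i t) (f θ)| < (|inner ℝ (v i) (f t)| + 2 * c) * b}
  have hUo : ∀ i, IsOpen (U i) := fun i => isOpen_lt (by fun_prop) continuous_const
  have hPU : ∀ i s, |s - t| ≤ b → P i s ∈ U i := by
    intro i s hs
    have h1 := hest i s t θ (by linarith [hδ'i i]) (by simpa using (hδ i).le)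
      (by rw [hθ, H.abs_tilt_sub hb]; linarith [hδ'i i])
    simp only [U, mem_ofPred_eq]
    rw [← inner_sub_left]
    have h2 : |inner ℝ (v i) (f t) * (s - t)| ≤ |inner ℝ (v i) (f t)| * b := by
      rw [abs_mul]; gcongr
    have h3 := abs_add_le (inner ℝ (P i s - P i t) (f θ) - inner ℝ (v i) (f t) * (s - t))
      (inner ℝ (v i) (f t) * (s - t))
    rw [sub_add_cancel] at h3
    nlinarith [abs_nonneg (s - t)]
  filter_upwards [hU (⋃ i, U i) (isOpen_iUnion hUo)
    fun i s hs => mem_iUnion.2 ⟨i, hPU i s hs⟩, self_mem_nhdsWithin] with ε hε hε0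
  have hε0 : 0 < ε := hε0
  have hsub : Λ ε ⊆ ⋃ i, (Λ ε ∩ U i) := by
    rw [← inter_iUnion]; exact subset_inter le_rfl hε
  calc volume (Λ ε) ≤ volume (⋃ i, (Λ ε ∩ U i)) := measure_mono hsub
    _ ≤ ∑ i, volume (Λ ε ∩ U i) := measure_iUnion_fintype_le _ _
    _ ≤ ∑ i, ENNReal.ofReal (ε * (1 + c) * (2 * ((|inner ℝ (v i) (f t)| + 2 * c) * b))) := by
        refine Finset.sum_le_sum fun i _ => ?_
        refine H.volume_le θ ((hΛ ε).inter (hUo i).measurableSet)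
          (fun p hp => (le_of_lt hp.2 : _)) ?_ (by positivity)
        intro p hp l hl hpl
        obtain ⟨s, hs, hls⟩ := hw ε hε0 p hp.1 l hl hpl.1
        have h1 := H.inner_e_tilt_e_ge hb hs
        have h2 := hcos b hb hb2
        nlinarith [mul_le_mul_of_nonneg_left h1 hl.le]
    _ = ENNReal.ofReal (ε * b * ((1 + c) * ∑ i, (2 * (|inner ℝ (v i) (f t)| + 2 * c)))) := by
        rw [← ENNReal.ofReal_sum_of_nonneg fun i _ => by positivity]
        congr 1
        rw [Finset.mul_sum, Finset.mul_sum]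
        exact Finset.sum_congr rfl fun i _ => by ring
    _ ≤ _ := ENNReal.ofReal_le_ofReal (by gcongr)

/-- The area of a set that contains a segment of length about `ε`, in the direction in which the
hallway moves, at every point of a short arc. -/
theorem exists_le_volume (H : IsFrame σ e f) {P : ℝ → Plane} {v : Plane} {t : ℝ}
    (hP : HasStrictDerivAt P v t) {η : ℝ} (hη : 0 < η) :
    ∃ δ > 0, ∃ c, 0 < c ∧ c < 1 ∧ ∀ b, 0 < b → b < δ → ∀ a, 0 < a → a < b → ∀ G : Set Plane,
      MeasurableSet G → ∀ ε > 0,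
      (∀ s, |s - t| ≤ a → ∀ u, 0 < u → u < (1 - c) * ε →
          P s + u • e (t + 2 * σ * b) ∈ G) ∨
        (∀ s, |s - t| ≤ a → ∀ u, 0 < u → u < (1 - c) * ε →
          P s + (-u) • e (t + 2 * σ * b) ∈ G) →
      ENNReal.ofReal (ε * a * (2 * |inner ℝ v (f t)| - η)) ≤ volume G := by
  set ρ := inner ℝ v (f t) with hρ
  -- This is what makes `2 (1 - c) (|ρ| - c) ≥ 2 |ρ| - η`: one loss in the section length, one in
  -- the extent of the arc.
  obtain ⟨c, hc, hc1, hcη⟩ : ∃ c, 0 < c ∧ c < 1 ∧ 2 * c * (1 + |ρ|) ≤ η := by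
    refine ⟨min (1 / 2) (η / (2 * (1 + |ρ|))), by positivity,
      (min_le_left _ _).trans_lt (by norm_num), ?_⟩
    have h1 : min (1 / 2) (η / (2 * (1 + |ρ|))) ≤ η / (2 * (1 + |ρ|)) := min_le_right _ _
    rw [le_div_iff₀ (by positivity)] at h1
    linarith
  obtain ⟨δ, hδ, hest⟩ := exists_inner_sub_estimate hP H.continuous_f hc
  obtain ⟨C, V, hV, hLip⟩ := hP.hasStrictFDerivAt.exists_lipschitzOnWith
  obtain ⟨δ', hδ', hδV⟩ := Metric.mem_nhds_iff.1 hV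
  refine ⟨min (δ / 2) δ', by positivity, c, hc, hc1, fun b hb hbδ a ha hab G hG ε hε hmem => ?_⟩
  have hb1 : b < δ / 2 := hbδ.trans_le (min_le_left _ _)
  have hb2 : b < δ' := hbδ.trans_le (min_le_right _ _)
  set θ := t + 2 * σ * b with hθ
  have hcont : ContinuousOn (fun s => inner ℝ (P s) (f θ)) (uIcc (t - a) (t + a)) := by
    refine (hLip.continuousOn.mono fun s hs => hδV ?_).inner continuousOn_const
    rw [uIcc_of_le (by linarith)] at hs
    rw [Metric.mem_ball, Real.dist_eq, abs_lt]
    constructor <;> linarith [hs.1, hs.2]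
  have h1 := hest (t + a) (t - a) θ (by rw [add_sub_cancel_left, abs_of_pos ha]; linarith)
    (by rw [sub_sub_cancel_left, abs_neg, abs_of_pos ha]; linarith)
    (by rw [hθ, H.abs_tilt_sub hb]; linarith)
  rw [inner_sub_left, show t + a - (t - a) = 2 * a by ring, abs_of_pos (by linarith : 0 < 2 * a)]
    at h1
  -- The arc need not be a graph over `f θ`. It suffices that every `f θ`-coordinate between those
  -- of its endpoints is attained.
  have hivt := intermediate_value_uIcc hcont
  set y₁ := inner ℝ (P (t - a)) (f θ)
  set y₂ := inner ℝ (P (t + a)) (f θ)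
  have hlen : 2 * a * (|ρ| - c) ≤ |y₂ - y₁| := by
    have h3 := abs_sub_abs_le_abs_sub (ρ * (2 * a)) (y₂ - y₁)
    rw [abs_sub_comm (ρ * (2 * a)), abs_mul, abs_of_pos (by linarith : 0 < 2 * a)] at h3
    linarith
  have hle := H.le_volume θ hG (w := (1 - c) * ε) (b₁ := min y₁ y₂) (b₂ := max y₁ y₂)
    (mul_nonneg (by linarith) hε.le) (by
      intro y hy
      obtain ⟨s, hs, hsy⟩ := hivt hy
      rw [uIcc_of_le (by linarith)] at hs
      have hst : |s - t| ≤ a := abs_le.2 ⟨by linarith [hs.1], by linarith [hs.2]⟩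
      refine ⟨P s, hsy, ?_⟩
      rcases hmem with hmem | hmem
      · exact Or.inl fun u hu => hmem s hst u hu.1 hu.2
      · exact Or.inr fun u hu => hmem s hst u hu.1 hu.2)
  refine le_trans (ENNReal.ofReal_le_ofReal ?_) hle
  rw [max_sub_min_eq_abs]
  have h2 : (1 - c) * ε * (2 * a * (|ρ| - c)) ≤ (1 - c) * ε * |y₂ - y₁| := by
    have : 0 ≤ (1 - c) * ε := mul_nonneg (by linarith) hε.le
    gcongr
  refine le_trans ?_ h2
  have : ε * a * (2 * |ρ| - η) ≤ ε * a * (2 * ((1 - c) * (|ρ| - c))) := by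
    gcongr
    nlinarith [abs_nonneg ρ]
  linarith

end IsFrame

/-! ### Localization in time -/

/-- If `p` lies inside the hallway at all times other than `t`, then it does so uniformly at the
times at distance at least `d` from `t`. -/
theorem exists_ball_subset_place {x : ℝ → Plane} (hx : ContinuousOn x (Icc 0 (Real.pi / 2)))
    {t d : ℝ} (hd : 0 < d) {p : Plane}
    (h : ∀ s ∈ Icc (0 : ℝ) (Real.pi / 2), s ≠ t → p ∈ interior (place x s L)) :
    ∃ r > 0, ∀ s ∈ Icc (0 : ℝ) (Real.pi / 2), d ≤ |s - t| → Metric.ball p r ⊆ place x s L := by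
  have hc : IsCompact (Icc (0 : ℝ) (Real.pi / 2) ∩ {s | d ≤ |s - t|}) :=
    isCompact_Icc.inter_right (isClosed_le continuous_const (by fun_prop))
  have := hc.induction_on (p := fun T => ∃ r > 0, ∀ s ∈ T, Metric.ball p r ⊆ place x s L)
    ⟨1, one_pos, by simp⟩ (fun T T' hT ⟨r, hr, h⟩ => ⟨r, hr, fun s hs => h s (hT hs)⟩)
    (fun T T' ⟨r, hr, h⟩ ⟨r', hr', h'⟩ => ⟨min r r', by positivity, fun s hs => by
      rcases hs with hs | hs
      · exact (Metric.ball_subset_ball (min_le_left _ _)).trans (h s hs)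
      · exact (Metric.ball_subset_ball (min_le_right _ _)).trans (h' s hs)⟩)
    (fun s hs => ?_)
  · obtain ⟨r, hr, h⟩ := this
    exact ⟨r, hr, fun s hs hds => h s ⟨hs, hds⟩⟩
  · have hst : s ≠ t := by
      rintro rfl
      have : d ≤ |s - s| := hs.2
      simp at this
      linarith
    have hint := mem_interior_iff_mem_nhds.1 (h s hs.1 hst)
    -- `Q (s', q)` has the same coordinates relative to the hallway at time `s` as `q` has at time
    -- `s'`. By continuity of `Q`, membership near `p` at time `s` spreads to neighbouring times.
    let Q : ℝ × Plane → Plane := fun q =>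
      x s + along x mu q.1 q.2 • mu s + along x nu q.1 q.2 • nu s
    have hQp : Q (s, p) = p := by
      have := isFrame_mu_nu.expand s (p - x s)
      simp only [Q, along, add_assoc, this]
      abel
    have hQ : ContinuousWithinAt Q (Icc 0 (Real.pi / 2) ×ˢ univ) (s, p) := by
      have hm : (s, p) ∈ Icc (0 : ℝ) (Real.pi / 2) ×ˢ (univ : Set Plane) := ⟨hs.1, mem_univ _⟩
      have h1 := continuousOn_along hx isFrame_mu_nu.continuous_e _ hm
      have h2 := continuousOn_along hx isFrame_mu_nu.continuous_f _ hm
      exact (continuousWithinAt_const.add (h1.smul continuousWithinAt_const)).add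
        (h2.smul continuousWithinAt_const)
    have hev := hQ (hQp.symm ▸ hint)
    rw [nhdsWithin_prod_eq, nhdsWithin_univ, mem_map] at hev
    obtain ⟨T, hT, U, hU, hTU⟩ := mem_prod_iff.1 hev
    obtain ⟨r, hr, hrU⟩ := Metric.mem_nhds_iff.1 hU
    refine ⟨T ∩ (Icc (0 : ℝ) (Real.pi / 2) ∩ {s | d ≤ |s - t|}),
      inter_mem (nhdsWithin_mono _ inter_subset_left hT) self_mem_nhdsWithin, r, hr,
      fun s' hs' q hq => ?_⟩
    have hm := hTU (mk_mem_prod hs'.1 (hrU hq))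
    rw [mem_preimage, mem_place_iff] at hm
    rw [mem_place_iff]
    have hsin : ∀ a b : ℝ, inner ℝ (x s + a • mu s + b • nu s - x s) (mu s) = a ∧
        inner ℝ (x s + a • mu s + b • nu s - x s) (nu s) = b := by
      intro a b
      rw [add_assoc, add_sub_cancel_left, inner_add_left, inner_smul_left, inner_smul_left,
        inner_add_left, inner_smul_left, inner_smul_left, isFrame_mu_nu.inner_ee,
        isFrame_mu_nu.inner_ff, isFrame_mu_nu.inner_ef, isFrame_mu_nu.inner_fe]
      simp
    rw [(hsin _ _).1, (hsin _ _).2] at hm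
    exact hm

/-- A continuous cutoff function near `t`. -/
structure IsCutoff (φ : ℝ → ℝ) (t a b : ℝ) : Prop where
  continuous : Continuous φ
  nonneg : ∀ s, 0 ≤ φ s
  le_one : ∀ s, φ s ≤ 1
  eq_one : ∀ s, |s - t| ≤ a → φ s = 1
  eq_zero : ∀ s, b ≤ |s - t| → φ s = 0

theorem exists_isCutoff (t : ℝ) {a b : ℝ} (hab : a < b) : ∃ φ, IsCutoff φ t a b := by
  refine ⟨fun s => max 0 (min 1 ((b - |s - t|) / (b - a))), by fun_prop, fun s => le_max_left _ _,
    fun s => max_le zero_le_one (min_le_left _ _), fun s hs => ?_, fun s hs => ?_⟩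
  · have : 1 ≤ (b - |s - t|) / (b - a) := by
      rw [le_div_iff₀ (by linarith)]; linarith
    simp [this]
  · have : (b - |s - t|) / (b - a) ≤ 0 :=
      div_nonpos_of_nonpos_of_nonneg (by linarith) (by linarith)
    simp [this]

namespace IsFrame

variable {σ : ℝ} {e f : ℝ → Plane}

theorem along_tilt (_ : IsFrame σ e f) (x : ℝ → Plane) (t b s u : ℝ) (p : Plane) :
    along x e s (p + u • e (t + 2 * σ * b)) =
        along x e s p + u * inner ℝ (e (t + 2 * σ * b)) (e s) ∧
      along x f s (p + u • e (t + 2 * σ * b)) =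
        along x f s p + u * inner ℝ (e (t + 2 * σ * b)) (f s) :=
  ⟨along_add_smul _ _ _ _ _ _, along_add_smul _ _ _ _ _ _⟩

theorem add_smul_mem_ball (H : IsFrame σ e f) {p q : Plane} {r u : ℝ} (θ : ℝ)
    (hpq : dist p q < r / 2) (hu : |u| < r / 2) : p + u • e θ ∈ Metric.ball q r := by
  rw [Metric.mem_ball]
  calc dist (p + u • e θ) q ≤ dist (p + u • e θ) p + dist p q := dist_triangle _ _ _
    _ = |u| + dist p q := by
        rw [dist_eq_norm, add_sub_cancel_left, norm_smul, H.norm_e, mul_one, Real.norm_eq_abs]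
    _ < r := by linarith

theorem mem_place_along (H : IsFrame σ e f) (x : ℝ → Plane) (s : ℝ) (p : Plane) :
    p ∈ place x s L ↔ along x e s p ≤ 1 ∧ along x f s p ≤ 1 ∧
      (0 ≤ along x e s p ∨ 0 ≤ along x f s p) := H.mem_place x s p

end IsFrame

theorem exists_pos_of_eventually {F : ℝ → Prop} {t : ℝ} (h : ∀ᶠ s in 𝓝 t, F s) :
    ∃ d > 0, ∀ s, |s - t| < d → F s := by
  obtain ⟨d, hd, h⟩ := Metric.eventually_nhds_iff.1 h
  exact ⟨d, hd, fun s hs => h hs⟩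

theorem exists_pos_of_eventually_prod {X : Type*} [PseudoMetricSpace X] {F : ℝ × X → Prop} {t : ℝ}
    {p : X} (h : ∀ᶠ q in 𝓝 (t, p), F q) :
    ∃ d > 0, ∀ s q, |s - t| < d → dist q p < d → F (s, q) := by
  obtain ⟨d, hd, h⟩ := Metric.eventually_nhds_iff.1 h
  refine ⟨d, hd, fun s q hs hq => h ?_⟩
  rw [Prod.dist_eq]
  exact max_lt hs hq

theorem continuousAt_along {x g : ℝ → Plane} (hx : ContinuousOn x (Icc 0 (Real.pi / 2)))
    (hg : Continuous g) {t : ℝ} (ht : t ∈ Ioo 0 (Real.pi / 2)) (p : Plane) :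
    ContinuousAt (fun q : ℝ × Plane => along x g q.1 q.2) (t, p) := by
  refine (continuousOn_along hx hg).continuousAt ?_
  exact prod_mem_nhds (Icc_mem_nhds ht.1 ht.2) univ_mem

/-- A uniform positive lower bound for a function of two times near `t`, away from the diagonal. -/
theorem eventually_forall_lt {g : ℝ × ℝ → ℝ} {t a' a d : ℝ} (ha : a' < a)
    (hg : ContinuousOn g (Icc (t - a') (t + a') ×ˢ Icc (t - d) (t + d)))
    (h : ∀ s s', |s - t| ≤ a' → |s' - t| ≤ d → s ≠ s' → 0 < g (s, s')) :
    ∀ᶠ ε in 𝓝[>] (0 : ℝ), ∀ s s', |s - t| ≤ a' → a ≤ |s' - t| → |s' - t| ≤ d → ε < g (s, s') := by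
  have hQ : IsCompact ((Icc (t - a') (t + a') ×ˢ Icc (t - d) (t + d)) ∩
      {q : ℝ × ℝ | a ≤ |q.2 - t|}) :=
    (isCompact_Icc.prod isCompact_Icc).inter_right (isClosed_le continuous_const (by fun_prop))
  -- With the empty set as target, the compactness principle says that `g` exceeds every small `ε`.
  have := IsCompact.eventually_mem_of_le (V := ∅) hQ isOpen_empty (hg.mono inter_subset_left)
    (fun q hq hle => by
      have h1 : |q.1 - t| ≤ a' := abs_le.2 ⟨by linarith [hq.1.1.1], by linarith [hq.1.1.2]⟩
      have h2 : |q.2 - t| ≤ d := abs_le.2 ⟨by linarith [hq.1.2.1], by linarith [hq.1.2.2]⟩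
      have h3 : a ≤ |q.2 - t| := hq.2
      have := h q.1 q.2 h1 h2 (by rintro h; rw [h] at h1; linarith)
      exact absurd hle (not_le.2 this))
  filter_upwards [this] with ε hε s s' h1 h2 h3
  by_contra hle
  have h1' := abs_le.1 h1
  have h3' := abs_le.1 h3
  exact hε (s, s') ⟨⟨⟨by linarith, by linarith⟩, ⟨by linarith, by linarith⟩⟩, h2⟩ (not_lt.1 hle)

theorem continuousOn_along_comp {x g P : ℝ → Plane} {J V W : Set ℝ} (hx : ContinuousOn x J)
    (hg : Continuous g) (hP : ContinuousOn P V) (hW : W ⊆ J) :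
    ContinuousOn (fun q : ℝ × ℝ => along x g q.2 (P q.1)) (V ×ˢ W) := by
  have h1 : ContinuousOn (fun q : ℝ × ℝ => P q.1) (V ×ˢ W) :=
    hP.comp continuousOn_fst fun q hq => hq.1
  have h2 : ContinuousOn (fun q : ℝ × ℝ => x q.2) (V ×ˢ W) :=
    hx.comp continuousOn_snd fun q hq => hW hq.2
  exact (h1.sub h2).inner (hg.comp continuous_snd).continuousOn

theorem exists_continuousOn_of_hasStrictDerivAt {P : ℝ → Plane} {v : Plane} {t : ℝ}
    (hP : HasStrictDerivAt P v t) : ∃ d > 0, ContinuousOn P (Metric.ball t d) := by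
  obtain ⟨C, V, hV, hLip⟩ := hP.hasStrictFDerivAt.exists_lipschitzOnWith
  obtain ⟨d, hd, hdV⟩ := Metric.mem_nhds_iff.1 hV
  exact ⟨d, hd, hLip.continuousOn.mono hdV⟩

theorem Icc_subset_ball {t a d : ℝ} (h : a < d) : Icc (t - a) (t + a) ⊆ Metric.ball t d := by
  intro s hs
  rw [Metric.mem_ball, Real.dist_eq, abs_lt]
  constructor <;> linarith [hs.1, hs.2]

/-! ### First-order gains of area -/

/-- The area gained at a contact point on the outer wall orthogonal to `e`, when the hallway moves
in the direction `e` for a short time. -/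
theorem IsFrame.outer_gain {σ : ℝ} {e f : ℝ → Plane} (H : IsFrame σ e f) {K : Set Plane}
    (hKc : IsClosed K) {x : ℝ → Plane} (hx : ContinuousOn x (Icc 0 (Real.pi / 2))) {t : ℝ}
    (ht : t ∈ Ioo 0 (Real.pi / 2)) {A : ℝ → Plane} {v : Plane} (hA : HasStrictDerivAt A v t)
    (hE : ∀ᶠ s in 𝓝 t, along x e s (A s) = 1) (hF : along x f t (A t) < 1)
    (hlt : ∀ᶠ q : ℝ × ℝ in 𝓝 (t, t), q.1 ≠ q.2 → along x e q.2 (A q.1) < 1)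
    (hK : A t ∈ interior K)
    (hint : ∀ s ∈ Icc (0 : ℝ) (Real.pi / 2), s ≠ t → A t ∈ interior (place x s L))
    {η : ℝ} (hη : 0 < η) :
    ∃ δ > 0, ∀ b, 0 < b → b < δ → ∀ a' a, 0 < a' → a' < a → a < b → ∀ φ, IsCutoff φ t a b →
      ∀ᶠ ε in 𝓝[>] (0 : ℝ), ENNReal.ofReal (ε * a' * (2 * |inner ℝ v (f t)| - η)) ≤
        volume (movedShape K x e f (fun s => ε * φ s) \ movedShape K x e f (fun _ => 0)) := by
  obtain ⟨d₁, hd₁, hE⟩ := exists_pos_of_eventually hE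
  obtain ⟨d₂, hd₂, hlt⟩ := exists_pos_of_eventually_prod hlt
  have hEt : along x e t (A t) = 1 := hE t (by simpa using hd₁)
  obtain ⟨d₃, hd₃, hloc⟩ := exists_pos_of_eventually_prod
    (((continuousAt_along hx H.continuous_f ht (A t)).eventually_lt_const hF).and
      ((continuousAt_along hx H.continuous_e ht (A t)).eventually_const_lt
        (u := 1 / 2) (by dsimp only; rw [hEt]; norm_num)))
  obtain ⟨d₄, hd₄, hAc⟩ := exists_continuousOn_of_hasStrictDerivAt hA
  obtain ⟨d₅, hd₅, hJ⟩ := exists_pos_of_eventually (Icc_mem_nhds ht.1 ht.2)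
  obtain ⟨d, hd, hdd⟩ : ∃ d > 0, d < min d₁ (min d₂ (min d₃ (min d₄ d₅))) :=
    exists_between (by positivity)
  simp only [lt_min_iff] at hdd
  obtain ⟨r₁, hr₁, hball⟩ := exists_ball_subset_place hx hd hint
  obtain ⟨r₂, hr₂, hballK⟩ := Metric.mem_nhds_iff.1 (mem_interior_iff_mem_nhds.1 hK)
  obtain ⟨r, hr, hrr⟩ : ∃ r > 0, r < min r₁ (min r₂ d₃) := exists_between (by positivity)
  simp only [lt_min_iff] at hrr
  obtain ⟨d₆, hd₆, hAr⟩ := exists_pos_of_eventually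
    (hA.hasDerivAt.continuousAt.eventually (Metric.ball_mem_nhds (A t) (half_pos hr)))
  obtain ⟨δ, hδ, c, hc, hc1, hvol⟩ := H.exists_le_volume hA hη
  refine ⟨min δ (min d (min d₆ (1 / 3))), by positivity,
    fun b hb hbδ a' a ha' haa hab φ hφ => ?_⟩
  simp only [lt_min_iff] at hbδ
  have hcont : ContinuousOn (fun q : ℝ × ℝ => 1 - along x e q.2 (A q.1))
      (Icc (t - a') (t + a') ×ˢ Icc (t - d) (t + d)) := by
    refine continuousOn_const.sub (continuousOn_along_comp hx H.continuous_e
      (hAc.mono (Icc_subset_ball (by linarith))) fun s hs => hJ s ?_)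
    have := Icc_subset_ball hdd.2.2.2.2 hs
    exact this
  -- The gap between `a'` and `a` is used here: points `A s` with `s` within `a'` of `t` keep a
  -- uniform margin from the wall at the times beyond `a`, where the cutoff may be less than one.
  have hmargin := eventually_forall_lt haa hcont (fun s s' hs hs' hne =>
    sub_pos.2 (hlt s s' (by linarith) (show |s' - t| < d₂ by linarith) hne))
  filter_upwards [hmargin, Ioo_mem_nhdsGT (show 0 < min (r / 2) (1 / 2) by positivity)]
    with ε hm hε
  have hε0 : 0 < ε := hε.1
  have hεr := lt_min_iff.1 hε.2
  refine hvol b hb hbδ.1 a' ha' (haa.trans hab) _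
    ((isClosed_movedShape hKc _ _ _ _).measurableSet.diff
      (isClosed_movedShape hKc _ _ _ _).measurableSet) ε hε0 (Or.inl fun s hs u hu hu1 => ?_)
  have huε : u < ε := by linarith [mul_pos hc hε0]
  set p := A s + u • e (t + 2 * σ * b) with hp
  have hpr : p ∈ Metric.ball (A t) r := H.add_smul_mem_ball _ (hAr s (by linarith))
    (by rw [abs_of_pos hu]; linarith)
  have hal := fun s' => H.along_tilt x t b s' u (A s)
  rw [← hp] at hal
  constructor
  · refine ⟨hballK (Metric.ball_subset_ball hrr.2.1.le hpr), fun s' hs' => ?_⟩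
    -- At far times the uniform ball applies. At near times either the wall has receded by the full
    -- `ε`, which exceeds `u`, or the margin does.
    rcases le_or_gt d |s' - t| with hfar | hnear
    · have := hball s' hs' hfar (Metric.ball_subset_ball hrr.1.le hpr)
      rw [H.mem_place_along] at this
      dsimp only
      rw [hφ.eq_zero s' (by linarith), mul_zero, add_zero]
      exact this
    · dsimp only
      have hl := hloc s' p (by linarith) (lt_trans hpr hrr.2.2)
      have hφ1 := hφ.le_one s'
      refine ⟨?_, hl.1.le, Or.inl (by
        have := mul_le_mul_of_nonneg_left hφ1 hε0.le
        linarith [hl.2])⟩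
      rw [(hal s').1]
      have hg := mul_le_mul_of_nonneg_left (H.inner_e_tilt_e_le t b s') hu.le
      rcases le_or_gt |s' - t| a with h | h
      · rw [hφ.eq_one s' h]
        have : along x e s' (A s) ≤ 1 := by
          rcases eq_or_ne s s' with rfl | hne
          · exact (hE s (by linarith)).le
          · exact (hlt s s' (by linarith) (show |s' - t| < d₂ by linarith) hne).le
        linarith
      · have := hm s s' hs h.le hnear.le
        linarith [mul_nonneg hε0.le (hφ.nonneg s')]
  · rintro ⟨-, hcon⟩
    have h1 := (hcon s (hJ s (by linarith))).1
    rw [(hal s).1, hE s (by linarith)] at h1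
    have h2 := H.inner_e_tilt_e_ge hb (t := t) (s := s) (by linarith)
    have : 0 < u * inner ℝ (e (t + 2 * σ * b)) (e s) :=
      mul_pos hu (by nlinarith)
    linarith

/-- The area gained at a contact point on the inner wall orthogonal to `e`, or at the inner corner,
when the hallway moves in the direction `-e` for a short time. -/
theorem IsFrame.inner_gain {σ : ℝ} {e f : ℝ → Plane} (H : IsFrame σ e f) {K : Set Plane}
    (hKc : IsClosed K) {x : ℝ → Plane} (hx : ContinuousOn x (Icc 0 (Real.pi / 2))) {t : ℝ}
    (ht : t ∈ Ioo 0 (Real.pi / 2)) {P : ℝ → Plane} {v : Plane} (hP : HasStrictDerivAt P v t)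
    (h0 : ∀ᶠ s in 𝓝 t, along x e s (P s) = 0 ∧ along x f s (P s) ≤ 0)
    {k : ℝ} (hk : 0 ≤ k)
    (h1 : ∀ᶠ q : ℝ × ℝ in 𝓝 (t, t), 0 ≤ along x e q.2 (P q.1) ∨
      (0 ≤ along x f q.2 (P q.1) ∧ -along x e q.2 (P q.1) ≤ k * along x f q.2 (P q.1)))
    (h2 : ∀ᶠ q : ℝ × ℝ in 𝓝 (t, t), q.1 ≠ q.2 →
      0 < along x e q.2 (P q.1) ∨ 0 < along x f q.2 (P q.1))
    (hK : P t ∈ interior K)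
    (hint : ∀ s ∈ Icc (0 : ℝ) (Real.pi / 2), s ≠ t → P t ∈ interior (place x s L))
    {η : ℝ} (hη : 0 < η) {R : ℝ} (hR : 0 < R) :
    ∃ δ > 0, ∀ b, 0 < b → b < δ → ∀ a' a, 0 < a' → a' < a → a < b → ∀ φ, IsCutoff φ t a b →
      ∀ᶠ ε in 𝓝[>] (0 : ℝ), ENNReal.ofReal (ε * a' * (2 * |inner ℝ v (f t)| - η)) ≤
        volume ((movedShape K x e f (fun s => -ε * φ s) \ movedShape K x e f (fun _ => 0)) ∩
          Metric.ball (P t) R) := by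
  obtain ⟨d₁, hd₁, h0⟩ := exists_pos_of_eventually h0
  obtain ⟨d₂, hd₂, h12⟩ := exists_pos_of_eventually_prod (h1.and h2)
  obtain ⟨hEt, hFt⟩ := h0 t (by simpa using hd₁)
  obtain ⟨d₃, hd₃, hloc⟩ := exists_pos_of_eventually_prod
    (((continuousAt_along hx H.continuous_f ht (P t)).eventually_lt_const (u := 1 / 2)
        (by linarith)).and
      ((continuousAt_along hx H.continuous_e ht (P t)).eventually_lt_const
        (u := 1 / 2) (by dsimp only; rw [hEt]; norm_num)))
  obtain ⟨d₄, hd₄, hPc⟩ := exists_continuousOn_of_hasStrictDerivAt hP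
  obtain ⟨d₅, hd₅, hJ⟩ := exists_pos_of_eventually (Icc_mem_nhds ht.1 ht.2)
  obtain ⟨d, hd, hdd⟩ : ∃ d > 0, d < min d₁ (min d₂ (min d₃ (min d₄ d₅))) :=
    exists_between (by positivity)
  simp only [lt_min_iff] at hdd
  obtain ⟨r₁, hr₁, hball⟩ := exists_ball_subset_place hx hd hint
  obtain ⟨r₂, hr₂, hballK⟩ := Metric.mem_nhds_iff.1 (mem_interior_iff_mem_nhds.1 hK)
  obtain ⟨r, hr, hrr⟩ : ∃ r > 0, r < min r₁ (min r₂ (min d₃ R)) := exists_between (by positivity)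
  simp only [lt_min_iff] at hrr
  obtain ⟨d₆, hd₆, hPr⟩ := exists_pos_of_eventually
    (hP.hasDerivAt.continuousAt.eventually (Metric.ball_mem_nhds (P t) (half_pos hr)))
  obtain ⟨δ, hδ, c, hc, hc1, hvol⟩ := H.exists_le_volume hP hη
  refine ⟨min δ (min d (min d₆ (min (1 / 3) (c / (3 * (k + 1)))))), by positivity,
    fun b hb hbδ a' a ha' haa hab φ hφ => ?_⟩
  simp only [lt_min_iff] at hbδ
  -- Retreating by `u` lowers the `f`-coordinate by at most `3bu`. If it becomes negative, the
  -- second alternative of `h1` bounds the initial deficit in the `e`-coordinate by `3bku ≤ cu`.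
  -- Together with `u < (1 - c)ε` the total deficit stays below `ε`, the distance by which the wall
  -- recedes.
  have hbk : 3 * b * k ≤ c := by
    have := hbδ.2.2.2.2
    rw [lt_div_iff₀ (by positivity)] at this
    nlinarith
  have hcont : ContinuousOn (fun q : ℝ × ℝ => max (along x e q.2 (P q.1)) (along x f q.2 (P q.1)))
      (Icc (t - a') (t + a') ×ˢ Icc (t - d) (t + d)) := by
    have hsub : Icc (t - d) (t + d) ⊆ Icc 0 (Real.pi / 2) := fun s hs =>
      hJ s (Icc_subset_ball hdd.2.2.2.2 hs)
    have hPc' := hPc.mono (Icc_subset_ball (t := t) (show a' < d₄ by linarith))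
    exact continuous_max.comp_continuousOn
      ((continuousOn_along_comp hx H.continuous_e hPc' hsub).prodMk
        (continuousOn_along_comp hx H.continuous_f hPc' hsub))
  have hmargin := eventually_forall_lt haa hcont (fun s s' hs hs' hne =>
    lt_max_iff.2 ((h12 s s' (by linarith) (show |s' - t| < d₂ by linarith)).2 hne))
  filter_upwards [hmargin, Ioo_mem_nhdsGT (show 0 < min (r / 2) (1 / 2) by positivity)]
    with ε hm hε
  have hε0 : 0 < ε := hε.1
  have hεr := lt_min_iff.1 hε.2
  refine hvol b hb hbδ.1 a' ha' (haa.trans hab) _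
    (((isClosed_movedShape hKc _ _ _ _).measurableSet.diff
      (isClosed_movedShape hKc _ _ _ _).measurableSet).inter Metric.isOpen_ball.measurableSet)
      ε hε0 (Or.inr fun s hs u hu hu1 => ?_)
  have huε : u < ε := by linarith [mul_pos hc hε0]
  set p := P s + (-u) • e (t + 2 * σ * b) with hp
  have hpr : p ∈ Metric.ball (P t) r := H.add_smul_mem_ball _ (hPr s (by linarith))
    (by rw [abs_neg, abs_of_pos hu]; linarith)
  have hal := fun s' => H.along_tilt x t b s' (-u) (P s)
  rw [← hp] at hal
  refine ⟨⟨?_, ?_⟩, Metric.ball_subset_ball hrr.2.2.2.le hpr⟩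
  · refine ⟨hballK (Metric.ball_subset_ball hrr.2.1.le hpr), fun s' hs' => ?_⟩
    rcases le_or_gt d |s' - t| with hfar | hnear
    · have := hball s' hs' hfar (Metric.ball_subset_ball hrr.1.le hpr)
      rw [H.mem_place_along] at this
      dsimp only
      rw [hφ.eq_zero s' (by linarith), mul_zero, add_zero]
      exact this
    · dsimp only
      have hl := hloc s' p (by linarith) (lt_trans hpr hrr.2.2.1)
      have hφ1 := hφ.le_one s'
      have hφ0 := hφ.nonneg s'
      have hεφ := mul_nonneg hε0.le hφ0
      have hεφ1 := mul_le_mul_of_nonneg_left hφ1 hε0.le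
      refine ⟨by linarith [hl.2], by linarith [hl.1], ?_⟩
      have hg := mul_le_mul_of_nonneg_left (H.inner_e_tilt_e_le t b s') hu.le
      rcases le_or_gt |s' - t| a with h | h
      · rw [hφ.eq_one s' h]
        have hgf := mul_le_mul_of_nonneg_left
          (H.inner_e_tilt_f_le hb (t := t) (s := s') (by linarith)) hu.le
        rw [or_iff_not_imp_right, not_le, (hal s').1, (hal s').2]
        intro hneg
        rcases (h12 s s' (by linarith) (show |s' - t| < d₂ by linarith)).1 with hE | ⟨hF, hEF⟩
        · linarith
        · have hFu : along x f s' (P s) ≤ u * (3 * b) := by linarith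
          have : k * along x f s' (P s) ≤ u * c := by
            calc k * along x f s' (P s) ≤ k * (u * (3 * b)) := by gcongr
              _ = u * (3 * b * k) := by ring
              _ ≤ u * c := by gcongr
          have h7 : u * c ≤ ε * c := mul_le_mul_of_nonneg_right huε.le hc.le
          linarith
      · have := hm s s' hs h.le hnear.le
        rcases lt_max_iff.1 this with h3 | h3
        · left
          rw [(hal s').1]
          linarith
        · right
          rw [(hal s').2]
          have : inner ℝ (e (t + 2 * σ * b)) (f s') ≤ 1 := by
            rw [H.inner_e_tilt_f]; exact Real.sin_le_one _
          linarith [mul_le_mul_of_nonneg_left this hu.le]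
  -- Because of the tilt both coordinates are negative at time `s`, so the point is cut off by the
  -- unmoved hallway.
  · rintro ⟨-, hcon⟩
    have h5 := (hcon s (hJ s (by linarith))).2.2
    rw [(hal s).1, (hal s).2, (h0 s (by linarith)).1] at h5
    have h3 := H.inner_e_tilt_e_ge hb (t := t) (s := s) (by linarith)
    have h4 := H.inner_e_tilt_f_pos hb (by linarith) (t := t) (s := s) (by linarith)
    have h6 : 0 < u * inner ℝ (e (t + 2 * σ * b)) (e s) := mul_pos hu (by nlinarith)
    have h7 := mul_pos hu h4
    have h8 := (h0 s (by linarith)).2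
    rcases h5 with h5 | h5 <;> linarith

/-! ### Rates of gain and comparison of areas -/

/-- The sets `G φ ε` have area at least about `2 a r ε`, if `φ` is a cutoff function for a short
interval of length `2 a` around `t`. -/
def GainsAtRate (t r : ℝ) (G : (ℝ → ℝ) → ℝ → Set Plane) : Prop :=
  ∀ η > 0, ∃ δ > 0, ∀ b, 0 < b → b < δ → ∀ a' a, 0 < a' → a' < a → a < b → ∀ φ, IsCutoff φ t a b →
    ∀ᶠ ε in 𝓝[>] (0 : ℝ), ENNReal.ofReal (ε * a' * (2 * r - η)) ≤ volume (G φ ε)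

/-- The required lower bound is negative. This disposes of contact points without speed in the
direction `f`, for which no isolation in time is available. -/
theorem gainsAtRate_zero (t : ℝ) (G : (ℝ → ℝ) → ℝ → Set Plane) : GainsAtRate t 0 G := by
  intro η hη
  refine ⟨1, one_pos, fun b _ _ a' a ha' _ _ φ _ => ?_⟩
  filter_upwards [self_mem_nhdsWithin] with ε hε
  have hε : 0 < ε := hε
  rw [ENNReal.ofReal_of_nonpos]
  · exact zero_le
  · have := mul_pos (mul_pos hε ha') hη
    linarith

theorem measure_diff_le_measure_diff {α : Type*} [MeasurableSpace α] {μ : Measure α} {S T : Set α}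
    (hS : MeasurableSet S) (hT : MeasurableSet T) (hle : μ S ≤ μ T) (hfin : μ T ≠ ⊤) :
    μ (S \ T) ≤ μ (T \ S) := by
  rw [← measure_inter_add_sdiff S hT, ← measure_inter_add_sdiff T hS, inter_comm T S] at hle
  refine (ENNReal.add_le_add_iff_left ?_).1 hle
  exact ((measure_mono inter_subset_right).trans_lt hfin.lt_top).ne

/-- Gains are proportional to the inner radius `a` and losses to the outer radius `b` of the cutoff.
Letting `a` tend to `b` at fixed `b` compares the rates. -/
theorem le_of_forall_ofReal_le {X Y b : ℝ} (hb : 0 < b) (hY : 0 ≤ Y)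
    (h : ∀ a, 0 < a → a < b → ∃ ε > 0,
      ENNReal.ofReal (ε * a * X) ≤ ENNReal.ofReal (ε * b * Y)) : X ≤ Y := by
  have key : ∀ a, 0 < a → a < b → a * X ≤ b * Y := by
    intro a ha hab
    obtain ⟨ε, hε, hle⟩ := h a ha hab
    rw [ENNReal.ofReal_le_ofReal_iff (by positivity), mul_assoc, mul_assoc] at hle
    exact le_of_mul_le_mul_left hle hε
  have hlim : Tendsto (fun a : ℝ => a * X) (𝓝[<] b) (𝓝 (b * X)) :=
    ((continuous_id.mul continuous_const).tendsto b).mono_left nhdsWithin_le_nhds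
  have := le_of_tendsto hlim (by
    filter_upwards [Ioo_mem_nhdsLT hb] with a ha using key a ha.1 ha.2)
  exact le_of_mul_le_mul_left this hb

namespace IsFrame

variable {σ : ℝ} {e f : ℝ → Plane} {K : Set Plane} {x : ℝ → Plane} {t : ℝ}

theorem isCompact_movedShape (hKc : IsClosed K) (hKb : Bornology.IsBounded K) (e f : ℝ → Plane)
    (h : ℝ → ℝ) : IsCompact (movedShape K x e f h) :=
  Metric.isCompact_of_isClosed_isBounded (isClosed_movedShape hKc x e f h)
    (hKb.subset fun _ hp => hp.1)

theorem continuousOn_along_swap (hx : ContinuousOn x (Icc 0 (Real.pi / 2))) {g : ℝ → Plane}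
    (hg : Continuous g) {S : Set Plane} {W : Set ℝ} (hW : W ⊆ Icc 0 (Real.pi / 2)) :
    ContinuousOn (fun q : Plane × ℝ => along x g q.2 q.1) (S ×ˢ W) := by
  have h2 : ContinuousOn (fun q : Plane × ℝ => x q.2) (S ×ˢ W) :=
    hx.comp continuousOn_snd fun q hq => hW hq.2
  exact (continuousOn_fst.sub h2).inner (hg.comp continuous_snd).continuousOn

/-! ### First-order losses of area -/

/-- The area lost at the inner walls when the hallway moves in the direction `e` for a short time. -/
theorem eventually_volume_inner_loss_le (H : IsFrame σ e f) (hKc : IsClosed K)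
    (hKb : Bornology.IsBounded K) (hx : ContinuousOn x (Icc 0 (Real.pi / 2)))
    (ht : t ∈ Ioo 0 (Real.pi / 2)) {ι : Type*} [Fintype ι] {P : ι → ℝ → Plane} {v : ι → Plane}
    (hP : ∀ i, HasStrictDerivAt (P i) (v i) t)
    (hcontact : ∀ᶠ s in 𝓝 t, ∀ p ∈ movedShape K x e f (fun _ => 0), along x e s p = 0 →
      along x f s p ≤ 0 → ∃ i, p = P i s) {η : ℝ} (hη : 0 < η) :
    ∃ δ > 0, ∀ b, 0 < b → b < δ → ∀ a φ, IsCutoff φ t a b →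
      ∀ᶠ ε in 𝓝[>] (0 : ℝ),
        volume (movedShape K x e f (fun _ => 0) \ movedShape K x e f (fun s => ε * φ s)) ≤
          ENNReal.ofReal (ε * b * (2 * ∑ i, |inner ℝ (v i) (f t)| + η)) := by
  obtain ⟨δ, hδ, hvol⟩ := H.eventually_volume_le hP hη
  obtain ⟨d₁, hd₁, hcontact⟩ := exists_pos_of_eventually hcontact
  obtain ⟨d₂, hd₂, hJ⟩ := exists_pos_of_eventually (Icc_mem_nhds ht.1 ht.2)
  refine ⟨min δ (min d₁ (min d₂ (1 / 3))), by positivity, fun b hb hbδ a φ hφ => ?_⟩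
  simp only [lt_min_iff] at hbδ
  set S := movedShape K x e f (fun _ => 0) with hS
  -- The lost points lie, at some time within `b` of `t`, behind the corner and in the layer of
  -- width `ε` that the inner wall sweeps.
  have key : ∀ ε > 0, ∀ p ∈ S \ movedShape K x e f (fun s => ε * φ s),
      ∃ s, |s - t| ≤ b ∧ 0 ≤ along x e s p ∧ along x e s p ≤ ε ∧ along x f s p < 0 := by
    intro ε hε p hp
    by_contra! hcon
    refine hp.2 ⟨hp.1.1, fun s hs => ?_⟩
    have h1 := hp.1.2 s hs
    simp only [add_zero] at h1 ⊢
    have h2 := mul_nonneg hε.le (hφ.nonneg s)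
    have h3 := mul_le_mul_of_nonneg_left (hφ.le_one s) hε.le
    refine ⟨by linarith, h1.2.1, ?_⟩
    rcases le_or_gt b |s - t| with h | h
    · rw [hφ.eq_zero s h, mul_zero]; exact h1.2.2
    · by_contra! hcc
      have hE : 0 ≤ along x e s p := h1.2.2.resolve_right (not_le.2 hcc.2)
      exact absurd (hcon s h.le hE (by linarith [hcc.1])) (not_le.2 hcc.2)
  refine hvol b hb hbδ.1 (fun ε => S \ movedShape K x e f (fun s => ε * φ s)) (fun ε =>
    (isClosed_movedShape hKc _ _ _ _).measurableSet.diff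
      (isClosed_movedShape hKc _ _ _ _).measurableSet) ?_ ?_
  · intro U hU hPU
    have hsub : Icc (t - b) (t + b) ⊆ Icc 0 (Real.pi / 2) := fun s hs =>
      hJ s (Icc_subset_ball hbδ.2.2.1 hs)
    -- The function is nonpositive exactly when `q.1` lies on the closed inner wall at time `q.2`.
    -- On the shape this means contact, so the lost set collapses onto the contact arcs.
    have := IsCompact.eventually_mem_of_le (V := Prod.fst ⁻¹' U)
      (g := fun q : Plane × ℝ => max |along x e q.2 q.1| (along x f q.2 q.1))
      ((isCompact_movedShape (x := x) hKc hKb e f (fun _ => 0)).prod isCompact_Icc)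
      (hU.preimage continuous_fst)
      (continuous_max.comp_continuousOn
        ((continuousOn_along_swap hx H.continuous_e hsub).abs.prodMk
          (continuousOn_along_swap hx H.continuous_f hsub)))
      (fun q hq hle => by
        have hq2 : |q.2 - t| ≤ b := abs_le.2 ⟨by linarith [hq.2.1], by linarith [hq.2.2]⟩
        obtain ⟨h1, h2⟩ := max_le_iff.1 hle
        obtain ⟨i, hi⟩ := hcontact q.2 (by linarith) q.1 hq.1
          (abs_eq_zero.1 (le_antisymm h1 (abs_nonneg _))) h2
        rw [mem_preimage, hi]
        exact hPU i q.2 hq2)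
    filter_upwards [this, self_mem_nhdsWithin] with ε hε hε0 p hp
    have hε0 : 0 < ε := hε0
    obtain ⟨s, hs, h1, h2, h3⟩ := key ε hε0 p hp
    have hs' := abs_le.1 hs
    exact hε (p, s) ⟨hp.1, ⟨by linarith, by linarith⟩⟩
      (max_le (by rw [abs_of_nonneg h1]; exact h2) (by linarith))
  · intro ε hε p hp l hl hpl
    obtain ⟨s, hs, h1, h2, h3⟩ := key ε hε _ hpl
    refine ⟨s, hs, ?_⟩
    rw [(H.along_tilt x t b s l p).1] at h1 h2
    rw [(H.along_tilt x t b s l p).2] at h3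
    -- The farther endpoint is behind the corner, hence by the tilt so is `p`. Since `p` belongs to
    -- the unmoved shape, its `e`-coordinate is nonnegative, and the segment fits into the swept
    -- layer.
    have h4 := mul_pos hl (H.inner_e_tilt_f_pos hb (by linarith) hs)
    have h5 := (hp.1.2 s (hJ s (by linarith))).2.2.resolve_right (by linarith)
    linarith

/-- The area lost at the outer wall when the hallway moves in the direction `-e` for a short
time. -/
theorem eventually_volume_outer_loss_le (H : IsFrame σ e f) (hKc : IsClosed K)
    (hKb : Bornology.IsBounded K) (hx : ContinuousOn x (Icc 0 (Real.pi / 2)))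
    (ht : t ∈ Ioo 0 (Real.pi / 2)) {A : ℝ → Plane} {v : Plane} (hA : HasStrictDerivAt A v t)
    (hcontact : ∀ᶠ s in 𝓝 t, ∀ p ∈ movedShape K x e f (fun _ => 0), along x e s p = 1 → p = A s)
    {η : ℝ} (hη : 0 < η) :
    ∃ δ > 0, ∀ b, 0 < b → b < δ → ∀ a φ, IsCutoff φ t a b →
      ∀ᶠ ε in 𝓝[>] (0 : ℝ),
        volume (movedShape K x e f (fun _ => 0) \ movedShape K x e f (fun s => -ε * φ s)) ≤
          ENNReal.ofReal (ε * b * (2 * |inner ℝ v (f t)| + η)) := by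
  obtain ⟨δ, hδ, hvol⟩ := H.eventually_volume_le (ι := Unit) (P := fun _ => A) (v := fun _ => v)
    (fun _ => hA) hη
  simp only [Finset.univ_unique, Finset.sum_singleton] at hvol
  obtain ⟨d₁, hd₁, hcontact⟩ := exists_pos_of_eventually hcontact
  obtain ⟨d₂, hd₂, hJ⟩ := exists_pos_of_eventually (Icc_mem_nhds ht.1 ht.2)
  refine ⟨min δ (min d₁ d₂), by positivity, fun b hb hbδ a φ hφ => ?_⟩
  simp only [lt_min_iff] at hbδ
  set S := movedShape K x e f (fun _ => 0) with hS
  have key : ∀ ε > 0, ∀ p ∈ S \ movedShape K x e f (fun s => -ε * φ s),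
      ∃ s, |s - t| ≤ b ∧ 1 - along x e s p ≤ ε := by
    intro ε hε p hp
    by_contra! hcon
    refine hp.2 ⟨hp.1.1, fun s hs => ?_⟩
    have h1 := hp.1.2 s hs
    simp only [add_zero] at h1 ⊢
    have h2 := mul_nonneg hε.le (hφ.nonneg s)
    have h3 := mul_le_mul_of_nonneg_left (hφ.le_one s) hε.le
    refine ⟨?_, h1.2.1, h1.2.2.imp_left fun h => by linarith⟩
    rcases le_or_gt b |s - t| with h | h
    · rw [hφ.eq_zero s h, mul_zero]; linarith [h1.1]
    · linarith [hcon s h.le]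
  refine hvol b hb hbδ.1 (fun ε => S \ movedShape K x e f (fun s => -ε * φ s)) (fun ε =>
    (isClosed_movedShape hKc _ _ _ _).measurableSet.diff
      (isClosed_movedShape hKc _ _ _ _).measurableSet) ?_ ?_
  · intro U hU hAU
    have hsub : Icc (t - b) (t + b) ⊆ Icc 0 (Real.pi / 2) := fun s hs =>
      hJ s (Icc_subset_ball hbδ.2.2 hs)
    have := IsCompact.eventually_mem_of_le (V := Prod.fst ⁻¹' U)
      (g := fun q : Plane × ℝ => 1 - along x e q.2 q.1)
      ((isCompact_movedShape (x := x) hKc hKb e f (fun _ => 0)).prod isCompact_Icc)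
      (hU.preimage continuous_fst)
      (continuousOn_const.sub (continuousOn_along_swap hx H.continuous_e hsub))
      (fun q hq hle => by
        have hq2 : |q.2 - t| ≤ b := abs_le.2 ⟨by linarith [hq.2.1], by linarith [hq.2.2]⟩
        have h1 := (hq.1.2 q.2 (hsub hq.2)).1
        rw [mem_preimage, hcontact q.2 (by linarith) q.1 hq.1 (by linarith)]
        exact hAU () q.2 hq2)
    filter_upwards [this, self_mem_nhdsWithin] with ε hε hε0 p hp
    have hε0 : 0 < ε := hε0
    obtain ⟨s, hs, h1⟩ := key ε hε0 p hp
    have hs' := abs_le.1 hs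
    exact hε (p, s) ⟨hp.1, ⟨by linarith, by linarith⟩⟩ h1
  · intro ε hε p hp l hl hpl
    obtain ⟨s, hs, h1⟩ := key ε hε _ hp
    refine ⟨s, hs, ?_⟩
    have h2 := (hpl.1.2 s (hJ s (by linarith))).1
    rw [(H.along_tilt x t b s l p).1] at h2
    linarith

/-! ### Inequalities between the rates -/

/-- At an area-maximizing path, moving the hallway in the direction `e` must not gain area:
the contact point on the outer wall moves at most as fast as those at the inner walls. -/
theorem outer_rate_le (H : IsFrame σ e f) (hKc : IsClosed K)
    (hKb : Bornology.IsBounded K) (hx : ContinuousOn x (Icc 0 (Real.pi / 2)))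
    (ht : t ∈ Ioo 0 (Real.pi / 2))
    (hmax : ∀ h : ℝ → ℝ, Continuous h → h 0 = 0 → h (Real.pi / 2) = 0 →
      volume (movedShape K x e f h) ≤ volume (movedShape K x e f (fun _ => 0)))
    {r : ℝ} (hgain : GainsAtRate t r fun φ ε =>
      movedShape K x e f (fun s => ε * φ s) \ movedShape K x e f (fun _ => 0))
    {ι : Type*} [Fintype ι] {P : ι → ℝ → Plane} {v : ι → Plane}
    (hP : ∀ i, HasStrictDerivAt (P i) (v i) t)
    (hcontact : ∀ᶠ s in 𝓝 t, ∀ p ∈ movedShape K x e f (fun _ => 0), along x e s p = 0 →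
      along x f s p ≤ 0 → ∃ i, p = P i s) :
    r ≤ ∑ i, |inner ℝ (v i) (f t)| := by
  refine le_of_forall_pos_le_add fun η hη => ?_
  obtain ⟨δ₁, hδ₁, hg⟩ := hgain η hη
  obtain ⟨δ₂, hδ₂, hl⟩ := H.eventually_volume_inner_loss_le hKc hKb hx ht hP hcontact hη
  -- The bounds by `t` and `π / 2 - t` make the perturbation vanish at both ends, so it yields an
  -- admissible rotation path.
  obtain ⟨b, hb, hbδ⟩ : ∃ b > 0, b < min (min δ₁ δ₂) (min t (Real.pi / 2 - t)) := by
    refine exists_between (lt_min (by positivity) (lt_min ht.1 (by linarith [ht.2])))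
  simp only [lt_min_iff] at hbδ
  have hsum : 0 ≤ ∑ i, |inner ℝ (v i) (f t)| := Finset.sum_nonneg fun i _ => abs_nonneg _
  have := le_of_forall_ofReal_le (X := 2 * r - η)
    (Y := 2 * ∑ i, |inner ℝ (v i) (f t)| + η) hb (by positivity) fun a' ha' hab => by
      obtain ⟨a, haa, hab⟩ := exists_between hab
      obtain ⟨φ, hφ⟩ := exists_isCutoff t hab
      obtain ⟨ε, ⟨h1, h2⟩, hε⟩ := (((hg b hb hbδ.1.1 a' a ha' haa hab φ hφ).and
        (hl b hb hbδ.1.2 a φ hφ)).and self_mem_nhdsWithin).exists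
      refine ⟨ε, hε, h1.trans (le_trans ?_ h2)⟩
      refine measure_diff_le_measure_diff (isClosed_movedShape hKc _ _ _ _).measurableSet
        (isClosed_movedShape hKc _ _ _ _).measurableSet (hmax _ ?_ ?_ ?_)
        (isCompact_movedShape hKc hKb _ _ _).measure_lt_top.ne
      · exact continuous_const.mul hφ.continuous
      · rw [hφ.eq_zero, mul_zero]
        rw [zero_sub, abs_neg, abs_of_pos ht.1]; exact hbδ.2.1.le
      · rw [hφ.eq_zero, mul_zero]
        rw [abs_of_pos (by linarith [ht.2])]; exact hbδ.2.2.le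
  linarith

/-- At an area-maximizing path, moving the hallway in the direction `-e` must not gain area:
the contact points at the inner walls move at most as fast as that on the outer wall. -/
theorem sum_inner_rate_le (H : IsFrame σ e f) (hKc : IsClosed K)
    (hKb : Bornology.IsBounded K) (hx : ContinuousOn x (Icc 0 (Real.pi / 2)))
    (ht : t ∈ Ioo 0 (Real.pi / 2))
    (hmax : ∀ h : ℝ → ℝ, Continuous h → h 0 = 0 → h (Real.pi / 2) = 0 →
      volume (movedShape K x e f h) ≤ volume (movedShape K x e f (fun _ => 0)))
    {A : ℝ → Plane} {v : Plane} (hA : HasStrictDerivAt A v t)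
    (hcontact : ∀ᶠ s in 𝓝 t, ∀ p ∈ movedShape K x e f (fun _ => 0), along x e s p = 1 → p = A s)
    {ι : Type*} [Fintype ι] {P : ι → Plane} (hP : Function.Injective P) {r : ι → ℝ}
    (hgain : ∀ i, ∀ R > 0, GainsAtRate t (r i) fun φ ε =>
      (movedShape K x e f (fun s => -ε * φ s) \ movedShape K x e f (fun _ => 0)) ∩
        Metric.ball (P i) R) :
    ∑ i, r i ≤ |inner ℝ v (f t)| := by
  -- Disjoint balls around the distinct contact points keep their gains from overlapping, so that
  -- they add up.
  obtain ⟨R, hRd, hR⟩ : ∃ R, (∀ i j, i ≠ j → Disjoint (Metric.ball (P i) R) (Metric.ball (P j) R)) ∧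
      0 < R := by
    have : ∀ᶠ R in 𝓝[>] (0 : ℝ), ∀ i j, i ≠ j →
        Disjoint (Metric.ball (P i) R) (Metric.ball (P j) R) := by
      rw [eventually_all]
      intro i
      rw [eventually_all]
      intro j
      rcases eq_or_ne i j with rfl | hij
      · exact Eventually.of_forall fun R h => absurd rfl h
      · filter_upwards [Ioo_mem_nhdsGT (half_pos (dist_pos.2 (hP.ne hij)))] with R hR _
        exact Metric.ball_disjoint_ball (by linarith [hR.2])
    exact (this.and self_mem_nhdsWithin).exists
  set n : ℝ := (Fintype.card ι : ℝ) with hn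
  have hn0 : 0 ≤ n := by positivity
  refine le_of_forall_pos_le_add fun η' hη' => ?_
  -- One error for each of the `n` gains and one for the loss.
  obtain ⟨η, hη, hηη'⟩ : ∃ η > 0, (n + 1) * η = η' :=
    ⟨η' / (n + 1), by positivity, by field_simp⟩
  choose δ₁ hδ₁ hg using fun i => hgain i R hR η hη
  obtain ⟨δ₂, hδ₂, hl⟩ := H.eventually_volume_outer_loss_le hKc hKb hx ht hA hcontact hη
  obtain ⟨b, hbi, hb, hbδ⟩ : ∃ b, (∀ i, b < δ₁ i) ∧ b ∈ Ioo 0 (min δ₂ (min t (Real.pi / 2 - t))) := by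
    have : ∀ᶠ b in 𝓝[>] (0 : ℝ), ∀ i, b < δ₁ i := by
      rw [eventually_all]
      intro i
      filter_upwards [Ioo_mem_nhdsGT (hδ₁ i)] with b hb using hb.2
    exact (this.and (Ioo_mem_nhdsGT (lt_min hδ₂ (lt_min ht.1 (by linarith [ht.2]))))).exists
  simp only [lt_min_iff] at hbδ
  have := le_of_forall_ofReal_le (X := ∑ i, (2 * r i - η))
    (Y := 2 * |inner ℝ v (f t)| + η) hb (by positivity) fun a' ha' hab => by
      obtain ⟨a, haa, hab⟩ := exists_between hab
      obtain ⟨φ, hφ⟩ := exists_isCutoff t hab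
      obtain ⟨ε, ⟨h1, h2⟩, hε⟩ := (((eventually_all.2 fun i =>
        hg i b hb (hbi i) a' a ha' haa hab φ hφ).and
        (hl b hb hbδ.1 a φ hφ)).and self_mem_nhdsWithin).exists
      refine ⟨ε, hε, le_trans ?_ h2⟩
      have hSm : ∀ h, MeasurableSet (movedShape K x e f h) := fun h =>
        (isClosed_movedShape hKc _ _ _ _).measurableSet
      calc ENNReal.ofReal (ε * a' * ∑ i, (2 * r i - η))
          ≤ ∑ i, ENNReal.ofReal (ε * a' * (2 * r i - η)) := by
            rw [Finset.mul_sum]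
            exact Finset.le_sum_of_subadditive ENNReal.ofReal ENNReal.ofReal_zero.le
              (fun _ _ => ENNReal.ofReal_add_le) _ _
        _ ≤ ∑ i, volume ((movedShape K x e f (fun s => -ε * φ s) \
              movedShape K x e f (fun _ => 0)) ∩ Metric.ball (P i) R) :=
            Finset.sum_le_sum fun i _ => h1 i
        _ = volume (⋃ i, (movedShape K x e f (fun s => -ε * φ s) \
              movedShape K x e f (fun _ => 0)) ∩ Metric.ball (P i) R) := by
            rw [measure_iUnion, tsum_fintype]
            · exact fun i j hij => (hRd i j hij).mono inter_subset_right inter_subset_right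
            · exact fun i => ((hSm _).diff (hSm _)).inter Metric.isOpen_ball.measurableSet
        _ ≤ volume (movedShape K x e f (fun s => -ε * φ s) \ movedShape K x e f (fun _ => 0)) :=
            measure_mono (iUnion_subset fun i => inter_subset_left)
        _ ≤ _ := by
            refine measure_diff_le_measure_diff (hSm _) (hSm _) (hmax _ ?_ ?_ ?_)
              (isCompact_movedShape hKc hKb _ _ _).measure_lt_top.ne
            · exact continuous_const.mul hφ.continuous
            · rw [hφ.eq_zero, mul_zero]
              rw [zero_sub, abs_neg, abs_of_pos ht.1]; exact hbδ.2.1.le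
            · rw [hφ.eq_zero, mul_zero]
              rw [abs_of_pos (by linarith [ht.2])]; exact hbδ.2.2.le
  rw [Finset.sum_sub_distrib, ← Finset.mul_sum, Finset.sum_const, Finset.card_univ, nsmul_eq_mul]
    at this
  linarith

end IsFrame

/-! ### Formulas for the contact points -/

theorem hasStrictDerivAt_deriv {x : ℝ → Plane} {t : ℝ} (hC : ContDiffAt ℝ 2 x t) :
    HasStrictDerivAt (deriv x) (deriv (deriv x) t) t ∧ ContDiffAt ℝ 1 (deriv x) t := by
  have h1 : ContDiffAt ℝ 1 (fderiv ℝ x) t := hC.fderiv_right (by norm_num)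
  have h2 : ContDiffAt ℝ 1 (fun s => fderiv ℝ x s 1) t := h1.clm_apply contDiffAt_const
  have h3 : ContDiffAt ℝ 1 (deriv x) t := by simpa only [fderiv_apply_one_eq_deriv] using h2
  exact ⟨h3.hasStrictDerivAt (by norm_num), h3⟩

theorem eventually_hasDerivAt {x : ℝ → Plane} {t : ℝ} (hC : ContDiffAt ℝ 2 x t) :
    ∀ᶠ s in 𝓝 t, HasDerivAt x (deriv x s) s := by
  filter_upwards [hC.eventually (by norm_num)] with s hs
  exact (hs.differentiableAt (by norm_num)).hasDerivAt

/-- The only possible contact point on the inner wall orthogonal to `e`. -/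
noncomputable def innerContact (σ : ℝ) (e f x : ℝ → Plane) (s : ℝ) : Plane :=
  x s + (σ * inner ℝ (deriv x s) (e s)) • f s

/-- The only possible contact point on the outer wall orthogonal to `e`. -/
noncomputable def outerContact (σ : ℝ) (e f x : ℝ → Plane) (s : ℝ) : Plane :=
  innerContact σ e f x s + e s

theorem hasDerivAt_along {x g : ℝ → Plane} {s : ℝ} {v w : Plane} (hx : HasDerivAt x v s)
    (hg : HasDerivAt g w s) (p : Plane) :
    HasDerivAt (fun r => along x g r p) (inner ℝ (p - x s) w - inner ℝ v (g s)) s := by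
  refine ((hx.const_sub p).inner ℝ hg).congr_deriv ?_
  rw [inner_neg_left]; ring

namespace IsFrame

variable {σ : ℝ} {e f : ℝ → Plane} {K : Set Plane} {x : ℝ → Plane} {t : ℝ}

theorem along_innerContact (H : IsFrame σ e f) (x : ℝ → Plane) (s : ℝ) :
    along x e s (innerContact σ e f x s) = 0 ∧
      along x f s (innerContact σ e f x s) = σ * inner ℝ (deriv x s) (e s) := by
  constructor
  · rw [innerContact, along_add_smul, H.inner_fe]; simp [along]
  · rw [innerContact, along_add_smul, H.inner_ff]; simp [along]

theorem along_outerContact (H : IsFrame σ e f) (x : ℝ → Plane) (s : ℝ) :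
    along x e s (outerContact σ e f x s) = 1 ∧
      along x f s (outerContact σ e f x s) = σ * inner ℝ (deriv x s) (e s) := by
  have h := H.along_innerContact x s
  constructor
  · rw [outerContact, ← one_smul ℝ (e s), along_add_smul, h.1, H.inner_ee]; simp
  · rw [outerContact, ← one_smul ℝ (e s), along_add_smul, h.2, H.inner_ef]; simp

theorem eq_of_along_eq (H : IsFrame σ e f) {s : ℝ} {p q : Plane}
    (h1 : along x e s p = along x e s q) (h2 : along x f s p = along x f s q) : p = q := by
  have hp := H.expand s (p - x s)
  have hq := H.expand s (q - x s)
  unfold along at h1 h2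
  rw [h1, h2, hq] at hp
  exact (sub_left_injective hp).symm

/-- For fixed `p` in the shape, the `e`-coordinate relative to the moving hallway never exceeds 1
and attains 1 at time `s`. Its vanishing derivative determines the `f`-coordinate of `p`. -/
theorem eq_outerContact (H : IsFrame σ e f) {s : ℝ} (hs : s ∈ Ioo 0 (Real.pi / 2))
    (hd : HasDerivAt x (deriv x s) s) {p : Plane} (hp : p ∈ movedShape K x e f (fun _ => 0))
    (h : along x e s p = 1) : p = outerContact σ e f x s := by
  have hmax : IsLocalMax (fun r => along x e r p) s := by
    filter_upwards [Icc_mem_nhds hs.1 hs.2] with r hr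
    rw [h]
    simpa using (hp.2 r hr).1
  have h0 := hmax.hasDerivAt_eq_zero (hasDerivAt_along hd (H.deriv_e s) p)
  refine H.eq_of_along_eq (h.trans (H.along_outerContact x s).1.symm) ?_
  rw [(H.along_outerContact x s).2]
  rw [inner_smul_right] at h0
  have := H.sq
  unfold along
  linear_combination σ * h0 - inner ℝ (p - x s) (f s) * this

/-- The strict inequality `hF` persists at nearby times, where membership in the hallway then forces
a nonnegative `e`-coordinate. So this coordinate has a local minimum at `s`, and Fermat applies
again. -/
theorem eq_innerContact (H : IsFrame σ e f) {s : ℝ} (hs : s ∈ Ioo 0 (Real.pi / 2))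
    (hd : HasDerivAt x (deriv x s) s) {p : Plane} (hp : p ∈ movedShape K x e f (fun _ => 0))
    (h : along x e s p = 0) (hF : along x f s p < 0) : p = innerContact σ e f x s := by
  have hmin : IsLocalMin (fun r => along x e r p) s := by
    filter_upwards [Icc_mem_nhds hs.1 hs.2,
      (hasDerivAt_along hd (H.deriv_f s) p).continuousAt.eventually_lt_const hF] with r hr hr2
    rw [h]
    exact (hp.2 r hr).2.2.resolve_right (not_le.2 hr2)
  have h0 := hmin.hasDerivAt_eq_zero (hasDerivAt_along hd (H.deriv_e s) p)
  refine H.eq_of_along_eq (h.trans (H.along_innerContact x s).1.symm) ?_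
  rw [(H.along_innerContact x s).2]
  rw [inner_smul_right] at h0
  have := H.sq
  unfold along
  linear_combination σ * h0 - inner ℝ (p - x s) (f s) * this

theorem contDiff_e (H : IsFrame σ e f) : ContDiff ℝ 1 e := by
  rw [contDiff_one_iff_deriv]
  refine ⟨fun s => (H.deriv_e s).differentiableAt, ?_⟩
  rw [show deriv e = fun s => σ • f s from funext fun s => (H.deriv_e s).deriv]
  exact H.continuous_f.const_smul σ

theorem contDiff_f (H : IsFrame σ e f) : ContDiff ℝ 1 f := by
  rw [contDiff_one_iff_deriv]
  refine ⟨fun s => (H.deriv_f s).differentiableAt, ?_⟩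
  rw [show deriv f = fun s => -(σ • e s) from funext fun s => (H.deriv_f s).deriv]
  exact (H.continuous_e.const_smul σ).neg

/-- The signed speed of the contact point on the inner wall orthogonal to `e`. -/
theorem hasStrictDerivAt_innerContact (H : IsFrame σ e f) (hC : ContDiffAt ℝ 2 x t) :
    HasStrictDerivAt (innerContact σ e f x)
      ((σ * (2 * (σ * inner ℝ (deriv x t) (f t)) + inner ℝ (deriv (deriv x) t) (e t))) • f t) t := by
  obtain ⟨h2, h3⟩ := hasStrictDerivAt_deriv hC
  have hx : HasDerivAt x (deriv x t) t := (hC.differentiableAt (by norm_num)).hasDerivAt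
  have hc : ContDiffAt ℝ 1 (innerContact σ e f x) t :=
    (hC.of_le (by norm_num)).add ((contDiffAt_const.mul
      (h3.inner ℝ H.contDiff_e.contDiffAt)).smul H.contDiff_f.contDiffAt)
  have hs := hc.hasStrictDerivAt (by norm_num)
  have hd : HasDerivAt (innerContact σ e f x) _ t :=
    hx.add (((h2.hasDerivAt.inner ℝ (H.deriv_e t)).const_mul σ).smul (H.deriv_f t))
  rw [hd.deriv] at hs
  refine hs.congr_deriv ?_
  -- The `e`-component of `x'` cancels against the term coming from `f' = -σe`: the contact point
  -- slides along its wall.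
  have hexp := H.expand t (deriv x t)
  have hsq := H.sq
  rw [inner_smul_right]
  conv_lhs => enter [1]; rw [← hexp]
  match_scalars
  · linear_combination -inner ℝ (deriv x t) (e t) * hsq
  · linear_combination -inner ℝ (deriv x t) (f t) * hsq

theorem hasStrictDerivAt_outerContact (H : IsFrame σ e f) (hC : ContDiffAt ℝ 2 x t) :
    HasStrictDerivAt (outerContact σ e f x)
      ((σ * (2 * (σ * inner ℝ (deriv x t) (f t)) + inner ℝ (deriv (deriv x) t) (e t) + 1)) •
        f t) t := by
  have he : HasStrictDerivAt e (σ • f t) t := by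
    have := H.contDiff_e.contDiffAt.hasStrictDerivAt (x := t) (by norm_num)
    rwa [(H.deriv_e t).deriv] at this
  refine ((H.hasStrictDerivAt_innerContact hC).add he).congr_deriv ?_
  module

end IsFrame

/-! ### The labelled walls and the two fixed arms -/

theorem contactPath_mem {x : ℝ → Plane} {w : Label} {s : ℝ} (h : w ∈ Gamma x s) :
    contactPath x w s ∈ contactSet x w s := by
  have h : (contactSet x w s).Nonempty := h
  rw [contactPath, dif_pos h]
  exact h.some_mem

theorem mem_place_wall_A (x : ℝ → Plane) (s : ℝ) (p : Plane) :
    p ∈ place x s (wall .A) ↔ along x mu s p = 1 ∧ along x nu s p ≤ 1 := by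
  rw [mem_place_iff]; simp [wall, along]

theorem mem_place_wall_B (x : ℝ → Plane) (s : ℝ) (p : Plane) :
    p ∈ place x s (wall .B) ↔ along x mu s p = 0 ∧ along x nu s p < 0 := by
  rw [mem_place_iff]; simp [wall, along]

theorem mem_place_wall_C (x : ℝ → Plane) (s : ℝ) (p : Plane) :
    p ∈ place x s (wall .C) ↔ along x nu s p = 1 ∧ along x mu s p ≤ 1 := by
  rw [mem_place_iff]; simp [wall, along]

theorem mem_place_wall_D (x : ℝ → Plane) (s : ℝ) (p : Plane) :
    p ∈ place x s (wall .D) ↔ along x nu s p = 0 ∧ along x mu s p < 0 := by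
  rw [mem_place_iff]; simp [wall, along]

theorem mem_place_wall_x (x : ℝ → Plane) (s : ℝ) (p : Plane) :
    p ∈ place x s (wall .x) ↔ p = x s := by
  simp only [place, wall, image_singleton, mem_singleton_iff]
  rw [show WithLp.toLp 2 (rotMat s *ᵥ (0 : Plane).ofLp) = 0 by simp, add_zero]

theorem isClosed_Lhoriz_inter (x : ℝ → Plane) :
    IsClosed (Lhoriz ∩ place x (Real.pi / 2) Lvert) := by
  have h1 : IsClosed Lhoriz := by
    have : Lhoriz = {p : Plane | p 0 ≤ 1} ∩ ({p | 0 ≤ p 1} ∩ {p | p 1 ≤ 1}) := rfl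
    rw [this]
    exact (isClosed_le (by fun_prop) (by fun_prop)).inter
      ((isClosed_le (by fun_prop) (by fun_prop)).inter (isClosed_le (by fun_prop) (by fun_prop)))
  have h2 : place x (Real.pi / 2) Lvert = {p | along x nu (Real.pi / 2) p ≤ 1} ∩
      ({p | 0 ≤ along x mu (Real.pi / 2) p} ∩ {p | along x mu (Real.pi / 2) p ≤ 1}) := by
    ext p
    rw [mem_place_iff]
    simp [Lvert, along]
  rw [h2]
  have he := continuous_along x mu (Real.pi / 2)
  have hf := continuous_along x nu (Real.pi / 2)
  exact h1.inter ((isClosed_le hf continuous_const).inter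
    ((isClosed_le continuous_const he).inter (isClosed_le he continuous_const)))

/-- The initial arm is bounded above, below and on the right; the final arm, turned by `π / 2`,
supplies the bound on the left. -/
theorem isBounded_Lhoriz_inter (x : ℝ → Plane) :
    Bornology.IsBounded (Lhoriz ∩ place x (Real.pi / 2) Lvert) := by
  rw [isBounded_iff_forall_norm_le]
  refine ⟨|(x (Real.pi / 2)) 0| + 1 + 1 + 1, ?_⟩
  rintro p ⟨⟨h1, h2, h3⟩, hp⟩
  rw [mem_place_iff] at hp
  have h4 : -(p 0 - (x (Real.pi / 2)) 0) ≤ 1 := by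
    have := hp.1
    simpa [inner_plane, nu] using this
  have h5 : |p 0| ≤ |(x (Real.pi / 2)) 0| + 1 + 1 := by
    rw [abs_le]
    have := neg_abs_le ((x (Real.pi / 2)) 0)
    constructor <;> linarith [abs_nonneg ((x (Real.pi / 2)) 0)]
  have h6 : |p 1| ≤ 1 := abs_le.2 ⟨by linarith, h3⟩
  rw [EuclideanSpace.norm_eq, Fin.sum_univ_two]
  refine (Real.sqrt_le_left (by positivity)).2 ?_
  simp only [Real.norm_eq_abs]
  nlinarith [abs_nonneg (p 0), abs_nonneg (p 1)]

theorem sum_bool_subtype (q : Bool → Prop) [DecidablePred q] (g : Bool → ℝ) :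
    ∑ i : {i // q i}, g i = (if q true then g true else 0) + (if q false then g false else 0) := by
  rw [← Finset.sum_subtype (Finset.univ.filter q) (by simp) g, Finset.sum_filter, Fintype.sum_bool]

/-- Local injectivity: the component of `P` in the direction `w` is strictly monotone near `t`. -/
theorem eventually_eq_imp_eq {P : ℝ → Plane} {v w : Plane} {t : ℝ} (hP : HasStrictDerivAt P v t)
    (h : inner ℝ v w ≠ 0) : ∀ᶠ q : ℝ × ℝ in 𝓝 (t, t), P q.1 = P q.2 → q.1 = q.2 := by
  obtain ⟨δ, hδ, hest⟩ := exists_inner_sub_estimate (g := fun _ => w) hP continuous_const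
    (half_pos (abs_pos.2 h))
  filter_upwards [prod_mem_nhds (Metric.ball_mem_nhds t hδ) (Metric.ball_mem_nhds t hδ)] with q hq heq
  have := hest q.1 q.2 t (le_of_lt hq.1) (le_of_lt hq.2) (by simpa using hδ.le)
  rw [heq, sub_self, inner_zero_left, zero_sub, abs_neg, abs_mul] at this
  have h0 : |q.1 - q.2| = 0 := by
    by_contra hne
    have h1 : 0 < |q.1 - q.2| := lt_of_le_of_ne (abs_nonneg _) (Ne.symm hne)
    have h2 := mul_pos (abs_pos.2 h) h1
    linarith
  exact sub_eq_zero.1 (abs_eq_zero.1 h0)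

theorem shape_eq_movedShape {σ : ℝ} {e f : ℝ → Plane} (H : IsFrame σ e f) (x : ℝ → Plane) :
    shape x = movedShape (Lhoriz ∩ place x (Real.pi / 2) Lvert) x e f (fun _ => 0) := by
  rw [← shape_add_smul H x rfl]
  simp

theorem volume_movedShape_le {σ : ℝ} {e f : ℝ → Plane} (H : IsFrame σ e f) {x : ℝ → Plane}
    (hx : IsRotationPath x) (hmax : IsAreaMaximal x) {h : ℝ → ℝ} (hc : Continuous h)
    (h0 : h 0 = 0) (h1 : h (Real.pi / 2) = 0) :
    volume (movedShape (Lhoriz ∩ place x (Real.pi / 2) Lvert) x e f h) ≤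
      volume (movedShape (Lhoriz ∩ place x (Real.pi / 2) Lvert) x e f (fun _ => 0)) := by
  rw [← shape_add_smul H x h1, ← shape_eq_movedShape H]
  refine hmax _ ⟨?_, by simp [h0, hx.2]⟩
  exact hx.1.add (hc.smul H.continuous_e).continuousOn

theorem eventually_prod_of_eventually {F : ℝ → Prop} {t : ℝ} (h : ∀ᶠ s in 𝓝 t, F s) :
    ∀ᶠ q : ℝ × ℝ in 𝓝 (t, t), F q.1 ∧ F q.2 := h.prod_nhds h

/-- The alternative in the definition of simple contacts: a contact point that moves is a contact
point only once. -/
theorem onlyAt_of_deriv_ne_zero {x : ℝ → Plane} {t : ℝ} (hsimple : SimpleContacts x t) {w : Label}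
    (hw : w ∈ Gamma x t) {P : ℝ → Plane} {v : Plane} (hP : HasStrictDerivAt P v t) (hv : v ≠ 0)
    (heq : ∀ᶠ s in 𝓝 t, contactPath x w s = P s) : OnlyAt x t (P t) := by
  rcases hsimple w hw with h | h
  · exfalso
    have hc : P =ᶠ[𝓝 t] fun _ => contactPath x w t := by
      filter_upwards [h, heq] with s h1 h2
      rw [← h2, h1]
    exact hv (hP.hasDerivAt.unique ((hasDerivAt_const t _).congr_of_eventuallyEq hc))
  · rwa [← heq.self_of_nhds]

/-! ### Gains at the actual contact points -/

section

variable {σ : ℝ} {e f x : ℝ → Plane} {t : ℝ}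

/-- If the contact point of time `s` also touched the outer wall at a nearby time `s'`, it would be
the contact point of time `s'`, against local injectivity. This supplies the strict inequality that
`IsFrame.outer_gain` requires. -/
theorem IsFrame.gainsAtRate_outer (H : IsFrame σ e f) (hx : IsRotationPath x)
    (ht : t ∈ Ioo 0 (Real.pi / 2)) (hC : ContDiffAt ℝ 2 x t)
    (hmem : ∀ᶠ s in 𝓝 t, outerContact σ e f x s ∈ shape x)
    (hout : along x f t (outerContact σ e f x t) < 1)
    {v : Plane} (hv : HasStrictDerivAt (outerContact σ e f x) v t)
    (hne : inner ℝ v (f t) ≠ 0) (honly : OnlyAt x t (outerContact σ e f x t)) :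
    GainsAtRate t |inner ℝ v (f t)| fun φ ε =>
      movedShape (Lhoriz ∩ place x (Real.pi / 2) Lvert) x e f (fun s => ε * φ s) \
        movedShape (Lhoriz ∩ place x (Real.pi / 2) Lvert) x e f (fun _ => 0) := by
  intro η hη
  rw [shape_eq_movedShape H] at hmem
  refine H.outer_gain (isClosed_Lhoriz_inter x) hx.1 ht hv
    (Eventually.of_forall fun s => (H.along_outerContact x s).1) hout ?_
    (by rw [interior_inter]; exact ⟨honly.1, honly.2.1⟩) honly.2.2 hη
  filter_upwards [eventually_eq_imp_eq hv hne, eventually_prod_of_eventually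
    ((hmem.and (eventually_hasDerivAt hC)).and (Ioo_mem_nhds ht.1 ht.2))] with q hq1 hq hne
  have h1 := (hq.1.1.1.2 q.2 (Ioo_subset_Icc_self hq.2.2)).1
  rw [add_zero] at h1
  refine lt_of_le_of_ne h1 fun h2 => hne (hq1 ?_)
  exact H.eq_outerContact hq.2.2 hq.2.1.2 hq.1.1.1 h2

/-- The same uniqueness argument applies. The `f`-coordinate stays negative nearby, so the corner
alternative of `IsFrame.inner_gain` does not occur and `k = 0` serves. -/
theorem IsFrame.gainsAtRate_inner (H : IsFrame σ e f) (hx : IsRotationPath x)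
    (ht : t ∈ Ioo 0 (Real.pi / 2)) (hC : ContDiffAt ℝ 2 x t)
    (hmem : ∀ᶠ s in 𝓝 t, innerContact σ e f x s ∈ shape x)
    (hin : along x f t (innerContact σ e f x t) < 0)
    {v : Plane} (hv : HasStrictDerivAt (innerContact σ e f x) v t)
    (hne : inner ℝ v (f t) ≠ 0) (honly : OnlyAt x t (innerContact σ e f x t)) {R : ℝ} (hR : 0 < R) :
    GainsAtRate t |inner ℝ v (f t)| fun φ ε =>
      (movedShape (Lhoriz ∩ place x (Real.pi / 2) Lvert) x e f (fun s => -ε * φ s) \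
        movedShape (Lhoriz ∩ place x (Real.pi / 2) Lvert) x e f (fun _ => 0)) ∩
          Metric.ball (innerContact σ e f x t) R := by
  intro η hη
  rw [shape_eq_movedShape H] at hmem
  have hF : ∀ᶠ q : ℝ × ℝ in 𝓝 (t, t), along x f q.2 (innerContact σ e f x q.1) < 0 := by
    have h1 : ContinuousAt (fun q : ℝ × ℝ => (q.2, innerContact σ e f x q.1)) (t, t) :=
      continuousAt_snd.prodMk (ContinuousAt.comp (f := Prod.fst) (x := (t, t))
        hv.hasDerivAt.continuousAt continuousAt_fst)
    have h2 : ContinuousAt (fun q : ℝ × ℝ => along x f q.2 (innerContact σ e f x q.1)) (t, t) :=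
      ContinuousAt.comp (g := fun q : ℝ × Plane => along x f q.1 q.2)
        (f := fun q : ℝ × ℝ => (q.2, innerContact σ e f x q.1)) (x := (t, t))
        (continuousAt_along hx.1 H.continuous_f ht _) h1
    exact h2.eventually_lt_const hin
  have hev := hF.and ((eventually_eq_imp_eq hv hne).and (eventually_prod_of_eventually
    ((hmem.and (eventually_hasDerivAt hC)).and (Ioo_mem_nhds ht.1 ht.2))))
  have hE : ∀ q : ℝ × ℝ, along x f q.2 (innerContact σ e f x q.1) < 0 →
      innerContact σ e f x q.1 ∈ movedShape (Lhoriz ∩ place x (Real.pi / 2) Lvert) x e f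
        (fun _ => 0) → q.2 ∈ Ioo 0 (Real.pi / 2) → 0 ≤ along x e q.2 (innerContact σ e f x q.1) :=
    fun q h1 h2 h3 => (h2.2 q.2 (Ioo_subset_Icc_self h3)).2.2.resolve_right (not_le.2 h1)
  refine H.inner_gain (isClosed_Lhoriz_inter x) hx.1 ht hv ?_ le_rfl ?_ ?_
    (by rw [interior_inter]; exact ⟨honly.1, honly.2.1⟩) honly.2.2 hη hR
  · have := (continuousAt_id.prodMk continuousAt_id : ContinuousAt (fun s : ℝ => (s, s)) t)
    filter_upwards [this.eventually hF] with s hs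
    exact ⟨(H.along_innerContact x s).1, le_of_lt hs⟩
  · filter_upwards [hev] with q hq
    exact Or.inl (hE q hq.1 hq.2.2.1.1.1 hq.2.2.2.2)
  · filter_upwards [hev] with q hq hqne
    refine Or.inl (lt_of_le_of_ne (hE q hq.1 hq.2.2.1.1.1 hq.2.2.2.2) fun h => hqne (hq.2.1 ?_))
    exact H.eq_innerContact hq.2.2.2.2 hq.2.2.2.1.2 hq.2.2.1.1.1 h.symm hq.1

/-- Relative to the hallway at time `s'`, the corner `x s` moves with positive `f`-speed in the
oriented time difference `τ = σ(s - s')`. For `τ > 0` it is ahead of the corner, with `e`-deficit at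
most a multiple of its `f`-coordinate. For `τ < 0` it is behind the corner, hence on the allowed
side of the inner wall. It is off that wall because the wall has no contact point, or else because
`σ⟨x', e⟩ < 0` pushes it away. -/
theorem IsFrame.gainsAtRate_corner (H : IsFrame σ e f) (hx : IsRotationPath x)
    (ht : t ∈ Ioo 0 (Real.pi / 2)) (hC : ContDiffAt ℝ 2 x t)
    (hmem : ∀ᶠ s in 𝓝 t, x s ∈ shape x)
    (hwall : (∀ᶠ s in 𝓝 t, ∀ p ∈ shape x, along x e s p = 0 → ¬ along x f s p < 0) ∨
      σ * inner ℝ (deriv x t) (e t) < 0)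
    (hpos : 0 < σ * inner ℝ (deriv x t) (f t)) (honly : OnlyAt x t (x t)) {R : ℝ} (hR : 0 < R) :
    GainsAtRate t |inner ℝ (deriv x t) (f t)| fun φ ε =>
      (movedShape (Lhoriz ∩ place x (Real.pi / 2) Lvert) x e f (fun s => -ε * φ s) \
        movedShape (Lhoriz ∩ place x (Real.pi / 2) Lvert) x e f (fun _ => 0)) ∩
          Metric.ball (x t) R := by
  intro η hη
  have hv : HasStrictDerivAt x (deriv x t) t := hC.hasStrictDerivAt (by norm_num)
  set α := σ * inner ℝ (deriv x t) (e t) with hα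
  set β := σ * inner ℝ (deriv x t) (f t) with hβ
  have hsq := H.sq
  have hα' : inner ℝ (deriv x t) (e t) = σ * α := by
    rw [hα, ← mul_assoc, hsq, one_mul]
  have hβ' : inner ℝ (deriv x t) (f t) = σ * β := by
    rw [hβ, ← mul_assoc, hsq, one_mul]
  -- estimates in terms of the oriented time difference
  have hest : ∀ (g : ℝ → Plane) (γ : ℝ), Continuous g → inner ℝ (deriv x t) (g t) = σ * γ →
      ∀ c > 0, ∀ᶠ q : ℝ × ℝ in 𝓝 (t, t),
        |along x g q.2 (x q.1) - γ * (σ * (q.1 - q.2))| ≤ c * |σ * (q.1 - q.2)| := by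
    intro g γ hg hγ c hc
    obtain ⟨δ, hδ, hest⟩ := exists_inner_sub_estimate hv hg hc
    filter_upwards [prod_mem_nhds (Metric.ball_mem_nhds t hδ) (Metric.ball_mem_nhds t hδ)]
      with q hq
    have := hest q.1 q.2 q.2 (le_of_lt hq.1) (le_of_lt hq.2) (le_of_lt hq.2)
    rw [hγ] at this
    rw [H.abs_sign_mul, show γ * (σ * (q.1 - q.2)) = σ * γ * (q.1 - q.2) by ring]
    exact this
  have hf := hest f β H.continuous_f hβ' (β / 2) (half_pos hpos)
  have he := hest e α H.continuous_e hα' 1 one_pos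
  rw [shape_eq_movedShape H] at hmem hwall
  have hS := eventually_prod_of_eventually (hmem.and (Ioo_mem_nhds ht.1 ht.2))
  have hE : ∀ q : ℝ × ℝ, along x f q.2 (x q.1) < 0 →
      x q.1 ∈ movedShape (Lhoriz ∩ place x (Real.pi / 2) Lvert) x e f
        (fun _ => 0) → q.2 ∈ Ioo 0 (Real.pi / 2) → 0 ≤ along x e q.2 (x q.1) :=
    fun q h1 h2 h3 => (h2.2 q.2 (Ioo_subset_Icc_self h3)).2.2.resolve_right (not_le.2 h1)
  have hzero : ∀ (g : ℝ → Plane) s, along x g s (x s) = 0 := fun g s => by simp [along]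
  refine H.inner_gain (isClosed_Lhoriz_inter x) hx.1 ht hv
    (Eventually.of_forall fun s => ⟨hzero e s, (hzero f s).le⟩)
    (k := (|α| + 1) * (2 / β)) (by positivity) ?_ ?_
    (by rw [interior_inter]; exact ⟨honly.1, honly.2.1⟩) honly.2.2 hη hR
  · filter_upwards [hf, he, hS] with q h1 h2 h3
    set τ := σ * (q.1 - q.2) with hτ
    rcases le_or_gt 0 τ with h | h
    · right
      rw [abs_of_nonneg h] at h1 h2
      have h1' := abs_le.1 h1
      have h2' := abs_le.1 h2
      have hF : β / 2 * τ ≤ along x f q.2 (x q.1) := by linarith [h1'.1]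
      refine ⟨le_trans (by positivity) hF, ?_⟩
      have hατ : -(α * τ) ≤ |α| * τ := by
        have := mul_le_mul_of_nonneg_right (neg_abs_le α) h
        linarith
      calc -along x e q.2 (x q.1) ≤ (|α| + 1) * τ := by linarith [h2'.1]
        _ = (|α| + 1) * (2 / β) * (β / 2 * τ) := by field_simp
        _ ≤ _ := by gcongr
    · left
      rw [abs_of_neg h] at h1
      have h1' := abs_le.1 h1
      have := mul_pos hpos (neg_pos.2 h)
      exact hE q (by linarith [h1'.2]) h3.1.1 h3.2.2
  · have hwall' : ∀ᶠ q : ℝ × ℝ in 𝓝 (t, t), σ * (q.1 - q.2) < 0 →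
        along x f q.2 (x q.1) < 0 → along x e q.2 (x q.1) ≠ 0 := by
      rcases hwall with hw | hw
      · filter_upwards [hS, eventually_prod_of_eventually hw] with q h1 h2 _ h3 h4
        exact h2.2 _ h1.1.1 h4 h3
      · filter_upwards [hest e α H.continuous_e hα' (-α / 2) (by linarith)] with q h1 h2 _ h4
        rw [h4, abs_of_neg h2] at h1
        have := mul_pos_of_neg_of_neg hw h2
        have h1' := abs_le.1 h1
        linarith [h1'.1]
    filter_upwards [hf, hS, hwall'] with q h1 h3 h4 hne
    set τ := σ * (q.1 - q.2) with hτ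
    have hτ0 : τ ≠ 0 := by
      refine mul_ne_zero (fun h => ?_) (sub_ne_zero.2 hne)
      rw [h] at hsq
      norm_num at hsq
    rcases lt_or_gt_of_ne hτ0 with h | h
    · left
      rw [abs_of_neg h] at h1
      have h1' := abs_le.1 h1
      have := mul_pos hpos (neg_pos.2 h)
      have hF : along x f q.2 (x q.1) < 0 := by linarith [h1'.2]
      exact lt_of_le_of_ne (hE q hF h3.1.1 h3.2.2) (h4 h hF).symm
    · right
      rw [abs_of_pos h] at h1
      have h1' := abs_le.1 h1
      have := mul_pos hpos h
      linarith [h1'.1]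

/-! ### The balance of gains and losses -/

open Classical in
/-- The balance of an area-maximizing path with respect to motions of the hallway in the
direction `e`. -/
theorem IsFrame.balance (H : IsFrame σ e f) (hx : IsRotationPath x)
    (ht : t ∈ Ioo 0 (Real.pi / 2)) (hC : ContDiffAt ℝ 2 x t) (hsimple : SimpleContacts x t)
    (hmax : IsAreaMaximal x) {wo wi : Label}
    (hwo : ∀ s p, p ∈ place x s (wall wo) ↔ along x e s p = 1 ∧ along x f s p ≤ 1)
    (hwi : ∀ s p, p ∈ place x s (wall wi) ↔ along x e s p = 0 ∧ along x f s p < 0)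
    {Γ : Set Label} (hΓ : ∀ᶠ s in 𝓝 t, Gamma x s = Γ) (ho : wo ∈ Γ)
    (hcorner : Label.x ∈ Γ → 0 ≤ σ * inner ℝ (deriv x t) (f t))
    (hout : along x f t (outerContact σ e f x t) < 1)
    (hwA : 0 ≤ σ * inner ℝ (deriv (contactPath x wo) t) (f t))
    (hwB : wi ∈ Γ → σ * inner ℝ (deriv (contactPath x wi) t) (f t) ≤ 0) :
    2 * (σ * inner ℝ (deriv x t) (f t)) + inner ℝ (deriv (deriv x) t) (e t) + 1 =
        (if Label.x ∈ Γ then σ * inner ℝ (deriv x t) (f t) else 0) +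
        (if wi ∈ Γ then
          -(2 * (σ * inner ℝ (deriv x t) (f t)) + inner ℝ (deriv (deriv x) t) (e t)) else 0) ∧
      HasDerivAt (contactPath x wo)
        ((σ * (2 * (σ * inner ℝ (deriv x t) (f t)) + inner ℝ (deriv (deriv x) t) (e t) + 1)) •
          f t) t := by
  set ρ := 2 * (σ * inner ℝ (deriv x t) (f t)) + inner ℝ (deriv (deriv x) t) (e t) with hρ
  have hsq := H.sq
  have hff : inner ℝ (f t) (f t) = 1 := by rw [H.inner_ff]; simp
  have hΓt : Gamma x t = Γ := hΓ.self_of_nhds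
  have hgood : ∀ᶠ s in 𝓝 t, Gamma x s = Γ ∧ HasDerivAt x (deriv x s) s ∧
      s ∈ Ioo 0 (Real.pi / 2) :=
    hΓ.and ((eventually_hasDerivAt hC).and (Ioo_mem_nhds ht.1 ht.2))
  have hshape := shape_eq_movedShape H x
  have hpo : ∀ᶠ s in 𝓝 t, contactPath x wo s = outerContact σ e f x s ∧
      outerContact σ e f x s ∈ shape x := by
    filter_upwards [hgood] with s hs
    have h1 := contactPath_mem (x := x) (w := wo) (s := s) (hs.1 ▸ ho)
    have h2 := H.eq_outerContact hs.2.2 hs.2.1 (hshape ▸ h1.1) ((hwo _ _).1 h1.2).1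
    exact ⟨h2, h2 ▸ h1.1⟩
  have hpi : wi ∈ Γ → ∀ᶠ s in 𝓝 t, contactPath x wi s = innerContact σ e f x s ∧
      innerContact σ e f x s ∈ shape x ∧ along x f s (innerContact σ e f x s) < 0 := by
    intro hi
    filter_upwards [hgood] with s hs
    have h1 := contactPath_mem (x := x) (w := wi) (s := s) (hs.1 ▸ hi)
    have h3 := (hwi _ _).1 h1.2
    have h2 := H.eq_innerContact hs.2.2 hs.2.1 (hshape ▸ h1.1) h3.1 h3.2
    exact ⟨h2, h2 ▸ h1.1, h2 ▸ h3.2⟩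
  have hpx : Label.x ∈ Γ → ∀ᶠ s in 𝓝 t, contactPath x .x s = x s ∧ x s ∈ shape x := by
    intro hi
    filter_upwards [hgood] with s hs
    have h1 := contactPath_mem (x := x) (w := .x) (s := s) (hs.1 ▸ hi)
    have h2 := (mem_place_wall_x _ _ _).1 h1.2
    exact ⟨h2, h2 ▸ h1.1⟩
  have hdo := H.hasStrictDerivAt_outerContact hC
  have hdi := H.hasStrictDerivAt_innerContact hC
  rw [← hρ] at hdo hdi
  have hdx : HasStrictDerivAt x (deriv x t) t := hC.hasStrictDerivAt (by norm_num)
  have hdcp : HasDerivAt (contactPath x wo) ((σ * (ρ + 1)) • f t) t :=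
    hdo.hasDerivAt.congr_of_eventuallyEq (hpo.mono fun s hs => hs.1)
  refine ⟨?_, hdcp⟩
  have hρA : 0 ≤ ρ + 1 := by
    rw [hdcp.deriv, inner_smul_left, hff] at hwA
    simp only [conj_trivial, mul_one] at hwA
    rwa [← mul_assoc, hsq, one_mul] at hwA
  have hρB : wi ∈ Γ → ρ ≤ 0 := by
    intro hi
    have h1 := hwB hi
    rw [(hdi.hasDerivAt.congr_of_eventuallyEq ((hpi hi).mono fun s hs => hs.1)).deriv,
      inner_smul_left, hff] at h1
    simp only [conj_trivial, mul_one] at h1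
    rwa [← mul_assoc, hsq, one_mul] at h1
  have hino : inner ℝ ((σ * (ρ + 1)) • f t) (f t) = σ * (ρ + 1) := by
    rw [inner_smul_left, hff]; simp
  have hini : inner ℝ ((σ * ρ) • f t) (f t) = σ * ρ := by
    rw [inner_smul_left, hff]; simp
  have habso : |inner ℝ ((σ * (ρ + 1)) • f t) (f t)| = ρ + 1 := by
    rw [hino, H.abs_sign_mul, abs_of_nonneg hρA]
  -- The index `true` stands for the inner corner and `false` for the inner wall. Only the contacts
  -- that are present are summed.
  let present : Bool → Prop := fun i => bif i then Label.x ∈ Γ else wi ∈ Γ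
  let P : Bool → ℝ → Plane := fun i => bif i then x else innerContact σ e f x
  let v : Bool → Plane := fun i => bif i then deriv x t else (σ * ρ) • f t
  have hP : ∀ i : {i // present i}, HasStrictDerivAt (P i) (v i) t := by
    rintro ⟨_ | _, -⟩
    · exact hdi
    · exact hdx
  have hwall : ∀ s, Gamma x s = Γ → ∀ p ∈ shape x, along x e s p = 0 → along x f s p < 0 →
      wi ∈ Γ := by
    intro s hs p hp h1 h2
    rw [← hs]
    exact ⟨p, hp, (hwi _ _).2 ⟨h1, h2⟩⟩
  have hcontacti : ∀ᶠ s in 𝓝 t, ∀ p ∈ movedShape (Lhoriz ∩ place x (Real.pi / 2) Lvert) x e f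
      (fun _ => 0), along x e s p = 0 → along x f s p ≤ 0 →
      ∃ i : {i // present i}, p = P i s := by
    filter_upwards [hgood] with s hs p hp h1 h2
    rcases h2.lt_or_eq with h2 | h2
    · exact ⟨⟨false, hwall s hs.1 p (hshape ▸ hp) h1 h2⟩,
        H.eq_innerContact hs.2.2 hs.2.1 hp h1 h2⟩
    · have hpx : p = x s := H.eq_of_along_eq (s := s) (x := x) (by rw [h1]; simp [along])
        (by rw [h2]; simp [along])
      refine ⟨⟨true, ?_⟩, hpx⟩
      change Label.x ∈ Γ
      rw [← hs.1]
      exact ⟨p, hshape ▸ hp, (mem_place_wall_x _ _ _).2 hpx⟩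
  have hcontacto : ∀ᶠ s in 𝓝 t, ∀ p ∈ movedShape (Lhoriz ∩ place x (Real.pi / 2) Lvert) x e f
      (fun _ => 0), along x e s p = 1 → p = outerContact σ e f x s := by
    filter_upwards [hgood] with s hs p hp h1
    exact H.eq_outerContact hs.2.2 hs.2.1 hp h1
  have hinj : Function.Injective fun i : {i // present i} => P i t := by
    have hne : wi ∈ Γ → innerContact σ e f x t ≠ x t := by
      intro hi heq
      have := (hpi hi).self_of_nhds.2.2
      rw [heq] at this
      simp [along] at this
    rintro ⟨_ | _, hi⟩ ⟨_ | _, hj⟩ hij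
    · rfl
    · exact absurd hij (hne hi)
    · exact absurd hij.symm (hne hj)
    · rfl
  have hgaino : GainsAtRate t (ρ + 1) fun φ ε =>
      movedShape (Lhoriz ∩ place x (Real.pi / 2) Lvert) x e f (fun s => ε * φ s) \
        movedShape (Lhoriz ∩ place x (Real.pi / 2) Lvert) x e f (fun _ => 0) := by
    -- A contact point of zero speed contributes nothing. One of nonzero speed is not stationary, so
    -- simplicity isolates it in time.
    rcases hρA.eq_or_lt with h0 | h0
    · rw [← h0]; exact gainsAtRate_zero _ _
    · have hne : inner ℝ ((σ * (ρ + 1)) • f t) (f t) ≠ 0 := by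
        rw [← abs_pos, habso]; exact h0
      have hne' : (σ * (ρ + 1)) • f t ≠ 0 := fun h => hne (by rw [h, inner_zero_left])
      rw [← habso]
      exact H.gainsAtRate_outer hx ht hC (hpo.mono fun s hs => hs.2) hout hdo hne
        (onlyAt_of_deriv_ne_zero hsimple (hΓt ▸ ho) hdo hne' (hpo.mono fun s hs => hs.1))
  have hgaini : ∀ i : {i // present i}, ∀ R > 0,
      GainsAtRate t |inner ℝ (v i) (f t)| fun φ ε =>
        (movedShape (Lhoriz ∩ place x (Real.pi / 2) Lvert) x e f (fun s => -ε * φ s) \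
          movedShape (Lhoriz ∩ place x (Real.pi / 2) Lvert) x e f (fun _ => 0)) ∩
            Metric.ball (P i t) R := by
    intro i R hR
    rcases eq_or_ne (inner ℝ (v i) (f t)) 0 with h0 | h0
    · rw [h0, abs_zero]; exact gainsAtRate_zero _ _
    · have hv0 : v i ≠ 0 := fun h => h0 (by rw [h, inner_zero_left])
      obtain ⟨_ | _, hi⟩ := i
      · have h1 := hpi hi
        exact H.gainsAtRate_inner hx ht hC (h1.mono fun s hs => hs.2.1) h1.self_of_nhds.2.2
          hdi h0 (onlyAt_of_deriv_ne_zero hsimple (hΓt ▸ hi) hdi hv0 (h1.mono fun s hs => hs.1)) hR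
      · have h1 := hpx hi
        refine H.gainsAtRate_corner hx ht hC (h1.mono fun s hs => hs.2) ?_ ?_
          (onlyAt_of_deriv_ne_zero hsimple (hΓt ▸ hi) hdx hv0 (h1.mono fun s hs => hs.1)) hR
        · by_cases hw : wi ∈ Γ
          · right
            rw [← (H.along_innerContact x t).2]
            exact (hpi hw).self_of_nhds.2.2
          · left
            filter_upwards [hgood] with s hs p hp h3 h4
            exact hw (hwall s hs.1 p hp h3 h4)
        · refine lt_of_le_of_ne (hcorner hi) (Ne.symm (mul_ne_zero ?_ h0))
          intro h
          rw [h] at hsq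
          norm_num at hsq
  have hle1 := H.outer_rate_le (isClosed_Lhoriz_inter x) (isBounded_Lhoriz_inter x) hx.1 ht
    (fun h hc h0 h1 => volume_movedShape_le H hx hmax hc h0 h1) hgaino hP hcontacti
  have hle2 := H.sum_inner_rate_le (isClosed_Lhoriz_inter x) (isBounded_Lhoriz_inter x) hx.1 ht
    (fun h hc h0 h1 => volume_movedShape_le H hx hmax hc h0 h1) hdo hcontacto hinj hgaini
  rw [habso] at hle2
  have heq := le_antisymm hle1 hle2
  rw [sum_bool_subtype present fun i => |inner ℝ (v i) (f t)|] at heq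
  rw [heq]
  congr 1
  · change (if Label.x ∈ Γ then |inner ℝ (deriv x t) (f t)| else 0) = _
    rw [← H.abs_sign_mul]
    split_ifs with h
    · exact abs_of_nonneg (hcorner h)
    · rfl
  · change (if wi ∈ Γ then |inner ℝ ((σ * ρ) • f t) (f t)| else 0) = _
    rw [hini, H.abs_sign_mul]
    split_ifs with h
    · exact abs_of_nonpos (hρB h)
    · rfl

end

/-! ### From the balance equations to the differential equations -/

theorem satisfiesODE_of_inner {x : ℝ → Plane} {t : ℝ} {v : Fin 2 → ℝ}
    {M : Matrix (Fin 2) (Fin 2) ℝ}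
    (h0 : inner ℝ (deriv (deriv x) t) (mu t) = v 0 + (M 0 0 * deriv x t 0 + M 0 1 * deriv x t 1))
    (h1 : inner ℝ (deriv (deriv x) t) (nu t) = v 1 + (M 1 0 * deriv x t 0 + M 1 1 * deriv x t 1)) :
    SatisfiesODE x t v M := by
  unfold SatisfiesODE
  rw [← isFrame_mu_nu.expand t (deriv (deriv x) t), h0, h1]
  ext i
  fin_cases i <;>
    simp [mu, nu, rotMat, Matrix.mulVec, dotProduct, Fin.sum_univ_two] <;> ring

/-- The outer corner of the hallway is not a contact point. -/
theorem along_outerContact_lt_one {x : ℝ → Plane} {t : ℝ} (ht : t ∈ Ioo 0 (Real.pi / 2))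
    (hwb : WellBehaved x t) (hA : .A ∈ Gamma x t) (hC : .C ∈ Gamma x t)
    (h : .x ∈ Gamma x t ∨ .B ∈ Gamma x t ∨ .D ∈ Gamma x t) :
    along x nu t (outerContact 1 mu nu x t) < 1 ∧ along x mu t (outerContact (-1) nu mu x t) < 1 := by
  have hd : HasDerivAt x (deriv x t) t := (hwb.contDiffAt.differentiableAt (by norm_num)).hasDerivAt
  have H1 := isFrame_mu_nu
  have H2 := isFrame_nu_mu
  have hs1 := shape_eq_movedShape H1 x
  have hs2 := shape_eq_movedShape H2 x
  have key : ∀ p ∈ shape x, along x mu t p = 1 → along x nu t p = 1 → False := by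
    intro p hp h1 h2
    have e1 := H1.eq_outerContact ht hd (hs1 ▸ hp) h1
    have e2 := H2.eq_outerContact ht hd (hs2 ▸ hp) h2
    -- A contact at the outer corner would give `⟨x', μ⟩ = 1` and `⟨x', ν⟩ = -1`. The latter
    -- contradicts the sign condition at the inner corner. The former puts a contact on `B`, and the
    -- latter one on `D`, on the wrong side of the inner corner.
    have f1 := (H1.along_outerContact x t).2
    have f2 := (H2.along_outerContact x t).2
    rw [← e1, h2] at f1
    rw [← e2, h1] at f2
    rcases h with h | h | h
    · have := (hwb.corner h).1
      linarith
    · have h3 := contactPath_mem h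
      have h4 := (mem_place_wall_B _ _ _).1 h3.2
      have h5 := H1.eq_innerContact ht hd (hs1 ▸ h3.1) h4.1 h4.2
      have h6 := h4.2
      rw [h5, (H1.along_innerContact x t).2] at h6
      linarith
    · have h3 := contactPath_mem h
      have h4 := (mem_place_wall_D _ _ _).1 h3.2
      have h5 := H2.eq_innerContact ht hd (hs2 ▸ h3.1) h4.1 h4.2
      have h6 := h4.2
      rw [h5, (H2.along_innerContact x t).2] at h6
      linarith
  constructor
  · have h1 := contactPath_mem hA
    have h2 := (mem_place_wall_A _ _ _).1 h1.2
    rw [← H1.eq_outerContact ht hd (hs1 ▸ h1.1) h2.1]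
    exact lt_of_le_of_ne h2.2 fun h3 => key _ h1.1 h2.1 h3
  · have h1 := contactPath_mem hC
    have h2 := (mem_place_wall_C _ _ _).1 h1.2
    rw [← H2.eq_outerContact ht hd (hs2 ▸ h1.1) h2.1]
    exact lt_of_le_of_ne h2.2 fun h3 => key _ h1.1 h3 h2.1

open Classical in
/-- The balance equations in both directions of the rotating frame. -/
theorem balance_equations {x : ℝ → Plane} (hx : IsRotationPath x) {t : ℝ}
    (ht : t ∈ Ioo 0 (Real.pi / 2)) (hwb : WellBehaved x t) (hsimple : SimpleContacts x t)
    (hmax : IsAreaMaximal x) {Γ : Set Label} (hΓ : ∀ᶠ s in 𝓝 t, Gamma x s = Γ)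
    (hA : .A ∈ Γ) (hC : .C ∈ Γ) (h : .x ∈ Γ ∨ .B ∈ Γ ∨ .D ∈ Γ) :
    (2 * inner ℝ (deriv x t) (nu t) + inner ℝ (deriv (deriv x) t) (mu t) + 1 =
        (if .x ∈ Γ then inner ℝ (deriv x t) (nu t) else 0) +
        (if .B ∈ Γ then
          -(2 * inner ℝ (deriv x t) (nu t) + inner ℝ (deriv (deriv x) t) (mu t)) else 0) ∧
      HasDerivAt (contactPath x .A)
        ((2 * inner ℝ (deriv x t) (nu t) + inner ℝ (deriv (deriv x) t) (mu t) + 1) • nu t) t) ∧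
    (-(2 * inner ℝ (deriv x t) (mu t)) + inner ℝ (deriv (deriv x) t) (nu t) + 1 =
        (if .x ∈ Γ then -inner ℝ (deriv x t) (mu t) else 0) +
        (if .D ∈ Γ then
          -(-(2 * inner ℝ (deriv x t) (mu t)) + inner ℝ (deriv (deriv x) t) (nu t)) else 0) ∧
      HasDerivAt (contactPath x .C)
        (-(-(2 * inner ℝ (deriv x t) (mu t)) + inner ℝ (deriv (deriv x) t) (nu t) + 1) • mu t)
        t) := by
  have hΓt : Gamma x t = Γ := hΓ.self_of_nhds
  have hout := along_outerContact_lt_one ht hwb (hΓt ▸ hA) (hΓt ▸ hC) (hΓt ▸ h)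
  constructor
  · have := isFrame_mu_nu.balance hx ht hwb.contDiffAt hsimple hmax (mem_place_wall_A x)
      (mem_place_wall_B x) hΓ hA
      (fun hc => by simpa using (hwb.corner (hΓt ▸ hc)).1) hout.1
      (by simpa using hwb.wallA (hΓt ▸ hA)) (fun hB => by simpa using hwb.wallB (hΓt ▸ hB))
    simpa only [one_mul] using this
  · have := isFrame_nu_mu.balance hx ht hwb.contDiffAt hsimple hmax (mem_place_wall_C x)
      (mem_place_wall_D x) hΓ hC
      (fun hc => by simpa using (hwb.corner (hΓt ▸ hc)).2) hout.2
      (by simpa using hwb.wallC (hΓt ▸ hC)) (fun hD => by simpa using hwb.wallD (hΓt ▸ hD))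
    simpa only [neg_one_mul, mul_neg] using this

end MovingSofa

open MovingSofa in
theorem theorem2 (x : ℝ → Plane) (hx : IsRotationPath x)
    (t : ℝ) (ht : t ∈ Set.Ioo (0 : ℝ) (Real.pi / 2))
    (hwb : WellBehaved x t) (hsimple : SimpleContacts x t) (hmax : IsAreaMaximal x) :
    ((∀ᶠ s in 𝓝 t, Gamma x s = {.A, .C, .D}) →
      SatisfiesODE x t ![-1, -1 / 2]
        !![2 * Real.sin t, -2 * Real.cos t; 2 * Real.cos t, 2 * Real.sin t] ∧
      HasDerivAt (contactPath x .A) 0 t) ∧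
    ((∀ᶠ s in 𝓝 t, Gamma x s = {.x, .A, .C, .D}) →
      SatisfiesODE x t ![-1, -1 / 2]
        !![Real.sin t, -Real.cos t; 3 / 2 * Real.cos t, 3 / 2 * Real.sin t]) ∧
    ((∀ᶠ s in 𝓝 t, Gamma x s = {.x, .A, .C}) →
      SatisfiesODE x t ![-1, -1]
        !![Real.sin t, -Real.cos t; Real.cos t, Real.sin t]) ∧
    ((∀ᶠ s in 𝓝 t, Gamma x s = {.x, .A, .B, .C}) →
      SatisfiesODE x t ![-1 / 2, -1]
        !![3 / 2 * Real.sin t, -(3 / 2) * Real.cos t; Real.cos t, Real.sin t]) ∧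
    ((∀ᶠ s in 𝓝 t, Gamma x s = {.A, .B, .C}) →
      SatisfiesODE x t ![-1 / 2, -1]
        !![2 * Real.sin t, -2 * Real.cos t; 2 * Real.cos t, 2 * Real.sin t] ∧
      HasDerivAt (contactPath x .C) 0 t) ∧
    ((∀ᶠ s in 𝓝 t, Gamma x s = {.x, .A, .B, .C, .D}) →
      SatisfiesODE x t ![-1 / 2, -1 / 2]
        !![3 / 2 * Real.sin t, -(3 / 2) * Real.cos t;
           3 / 2 * Real.cos t, 3 / 2 * Real.sin t]) := by
  have hmu : inner ℝ (deriv x t) (mu t) = deriv x t 0 * Real.cos t + deriv x t 1 * Real.sin t := by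
    simp [inner_plane, mu]
  have hnu : inner ℝ (deriv x t) (nu t) =
      -(deriv x t 0 * Real.sin t) + deriv x t 1 * Real.cos t := by
    simp [inner_plane, nu]
  have hbal := fun (Γ : Set Label) => balance_equations hx ht hwb hsimple hmax (Γ := Γ)
  refine ⟨fun hΓ => ?_, fun hΓ => ?_, fun hΓ => ?_, fun hΓ => ?_, fun hΓ => ?_, fun hΓ => ?_⟩
  all_goals
    obtain ⟨⟨h1, hA⟩, ⟨h2, hC⟩⟩ := hbal _ hΓ (by simp) (by simp) (by simp)
    simp only [mem_insert_iff, mem_singleton_iff, reduceCtorEq, or_false, or_true,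
      if_true, if_false] at h1 h2
  -- With neither the inner corner nor `B` in contact, nothing can offset the gain at `A`: the
  -- balance says that the velocity of `A` is zero.
  · rw [h1] at hA
    refine ⟨satisfiesODE_of_inner ?_ ?_, by simpa using hA⟩ <;> simp <;>
      linarith
  · refine satisfiesODE_of_inner ?_ ?_ <;> simp <;> linarith
  · refine satisfiesODE_of_inner ?_ ?_ <;> simp <;> linarith
  · refine satisfiesODE_of_inner ?_ ?_ <;> simp <;> linarith
  · rw [h2] at hC
    refine ⟨satisfiesODE_of_inner ?_ ?_, by simpa using hC⟩ <;> simp <;> linarith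
  · refine satisfiesODE_of_inner ?_ ?_ <;> simp <;> linarith
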